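/- Let $p\in\mathbb N$, let $\Theta\subset\mathbb{R}^p$ be compact and let $\theta_0=(\theta_{01},\dots,\theta_{0p})$ lie in the interior of $\Theta$. For $n\ge 1$ let $X_1,\dots,X_n\in\mathbb{R}^p$ be non-random covariates (they may depend on $n$) and let $$Y_i=\theta_0^\top X_i+\epsilon_i,\qquad i=1,\dots,n .$$ For $\gamma>0$ and real tuning parameters $\lambda_n$, let $\hat\theta_n$ be a (measurable) minimizer over $\Theta$ of $$Z_n(\theta)=\sum_{i=1}^n (Y_i-\theta^\top X_i)^2+\lambda_n\sum_{j=1}^p|\theta_j|^\gamma ,$$ and put $\hat u_n=\sqrt n(\hat\theta_n-\theta_0)$ and $C_n=n^{-1}\sum_{i=1}^n X_iX_i^\top$. Suppose that 1. $\lambda_n/n^{(1\wedge\gamma)/2}\to\lambda_0$ for some $\lambda_0\ge 0$; 2. $\epsilon_1,\epsilon_2,\dots$ are i.i.d. with $E[\epsilon_i]=0$ and $E[|\epsilon_i|^k]<\infty$ for all $k>0$; write $\sigma^2=E[\epsilon_i^2]$; 3. for some $\delta>0$ and some symmetric positive definite matrix $C_0$, $\sup_{n\ge1} n^\delta|C_n-C_0|<\infty$;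 4. $\sup_{n\ge1}\sup_{i\le n}|X_i|<\infty$. Then for every $L>0$ there is a constant $c_L>0$ such that $$\sup_{n\ge1}P(|\hat u_n|\ge r)\le \frac{c_L}{r^L}\qquad\text{for all } r>0 .$$ Further, let $W\sim N_p(0,\sigma^2C_0)$ and $$V_0(u)=-2W^\top u+u^\top C_0u+\begin{cases}\gamma\lambda_0\sum_{j=1}^p u_j\,\mathrm{sgn}(\theta_{0j})|\theta_{0j}|^{\gamma-1}&(\gamma>1),\\[2pt] \lambda_0\sum_{j=1}^p\{u_j\,\mathrm{sgn}(\theta_{0j})\mathbf 1(\theta_{0j}\ne0)+|u_j|\mathbf 1(\theta_{0j}=0)\}&(\gamma=1),\\[2pt] \lambda_0\sum_{j=1}^p|u_j|^\gamma\mathbf 1(\theta_{0j}=0)&(\gamma<1).\end{cases}$$ Then $V_0$ has almost surely exactly one minimizer $\hat u_0=\operatorname{argmin}(V_0)$ over $\mathbb{R}^p$, and for every continuous $f:\mathbb{R}^p\to\mathbb{R}$ of at most polynomial growth the expectations below are finite and $$E[f(\hat u_n)]\to E[f(\hat u_0)]\qquad (n\to\infty).$$ -/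

import Mathlib

open MeasureTheory ProbabilityTheory Filter Topology
open scoped Matrix Matrix.Norms.Frobenius

universe a b

noncomputable section

/-- The bridge least-squares contrast
`∑ (Y i - θᵀ X i)² + lam * ∑ |θ j| ^ γ`, the first sum running over the `n` observations
with labels `0, …, n - 1`. -/
def bridgeContrast {p : ℕ} (n : ℕ) (X : ℕ → EuclideanSpace ℝ (Fin p)) (Y : ℕ → ℝ)
    (lam γ : ℝ) (θ : EuclideanSpace ℝ (Fin p)) : ℝ :=
  ∑ i ∈ Finset.range n, (Y i - inner ℝ θ (X i)) ^ 2 + lam * ∑ j, |θ j| ^ γ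

/-- The normalized Gram matrix `n⁻¹ ∑ X i (X i)ᵀ` of the `n` covariates `X 0, …, X (n - 1)`. -/
def gramMean {p : ℕ} (n : ℕ) (X : ℕ → EuclideanSpace ℝ (Fin p)) : Matrix (Fin p) (Fin p) ℝ :=
  (n : ℝ)⁻¹ • ∑ i ∈ Finset.range n, Matrix.vecMulVec (X i) (X i)

/-- The penalty part of the limit random field, in the three regimes of the bridge index. -/
def limitPenalty {p : ℕ} (θ₀ : EuclideanSpace ℝ (Fin p)) (γ lam₀ : ℝ)
    (u : EuclideanSpace ℝ (Fin p)) : ℝ :=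
  if 1 < γ then γ * lam₀ * ∑ j, u j * Real.sign (θ₀ j) * |θ₀ j| ^ (γ - 1)
  else if γ = 1 then lam₀ * ∑ j, (if θ₀ j = 0 then |u j| else u j * Real.sign (θ₀ j))
  else lam₀ * ∑ j, (if θ₀ j = 0 then |u j| ^ γ else 0)

/-- The limit random field `V₀(u) = -2 wᵀ u + uᵀ C₀ u + penalty`, where `w` is the value of the
Gaussian vector `W`. -/
def limitField {p : ℕ} (C₀ : Matrix (Fin p) (Fin p) ℝ) (θ₀ : EuclideanSpace ℝ (Fin p))
    (γ lam₀ : ℝ) (w u : EuclideanSpace ℝ (Fin p)) : ℝ :=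
  -2 * inner ℝ w u + u.ofLp ⬝ᵥ (C₀ *ᵥ u.ofLp) + limitPenalty θ₀ γ lam₀ u

/-- `f` is of at most polynomial growth. -/
def PolynomialGrowth {E : Type*} [Norm E] (f : E → ℝ) : Prop :=
  ∃ (K : ℝ) (k : ℕ), ∀ x, |f x| ≤ K * (1 + ‖x‖) ^ k

end

/-!
In the local coordinate `u = √n (θ - θ₀)` the increment of the contrast is
`-2 Sₙᵀ u + gₙ(u)` (`bridgeContrast_sub_eq_tiltedField`): the randomness enters only through the
linear term, with the normalized score `Sₙ = n ^ (-1/2) ∑ ε i X i`, and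
`gₙ(u) = uᵀ Cₙ u + penalty increment` is deterministic. The limit field has the same shape, with
the Gaussian vector `W` in place of `Sₙ` and `g(u) = uᵀ C₀ u + limit penalty`.

Tails. The penalty increment grows at most linearly in `u`, uniformly in `n`, on the rescaled
parameter space, while the Gram matrices are eventually uniformly positive definite. As the
estimator does at least as well as `u = 0`, this gives `‖ûₙ‖ ≤ A (1 + ‖Sₙ‖)` with a deterministic
`A` (`exists_norm_le_of_localDrift`). The moments of `Sₙ` are bounded in `n`
(`exists_integral_one_add_norm_score_pow_le`), and Markov's inequality yields the polynomial
large deviation inequality.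

Uniqueness. For `γ ≥ 1` the limit field is strictly convex. For `γ < 1` and nondegenerate noise, the
minimal value of `u ↦ -2 wᵀ u + g(u)` is a locally Lipschitz function of `w`, hence differentiable
Lebesgue almost everywhere, and at such points its gradient determines the minimizer
(`ae_unique_isMinOn_tiltedField`); the law of `W` is absolutely continuous. For degenerate noise
`W = 0` and the minimizer is the origin.

Convergence. The score is asymptotically normal (`tendsto_charFun_normalizedScore`, by comparison of
characteristic functions and Lévy's theorem). The drifts `gₙ` converge continuously to `g`
(`tendsto_penaltyIncrement`), so minimizers for tilts `sₙ → s` converge to the minimizer for `s`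
whenever the latter is unique (`tendsto_argmin_tiltedField`). A continuous mapping theorem for
relations (`tendstoInDistribution_of_relation`) transfers the convergence in distribution of the
scores to the minimizers, without any choice of measurable argmin maps, and the moment bounds
upgrade it to convergence of expectations (`tendsto_integral_of_tendstoInDistribution`).
-/

/-! ### The rescaled penalty -/

/-- The contribution of one coordinate to `limitPenalty`, without the factor `lam₀`: the limit of
`n ^ (min 1 γ / 2) * (|a + x / √n| ^ γ - |a| ^ γ)`. -/
noncomputable def coordLimitPenalty (a γ x : ℝ) : ℝ :=
  if 1 < γ then γ * (x * Real.sign a * |a| ^ (γ - 1))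
  else if γ = 1 then (if a = 0 then |x| else x * Real.sign a)
  else (if a = 0 then |x| ^ γ else 0)

lemma limitPenalty_eq_sum {p : ℕ} (θ₀ : EuclideanSpace ℝ (Fin p)) (γ lam₀ : ℝ)
    (u : EuclideanSpace ℝ (Fin p)) :
    limitPenalty θ₀ γ lam₀ u = lam₀ * ∑ j, coordLimitPenalty (θ₀ j) γ (u j) := by
  unfold limitPenalty coordLimitPenalty
  split_ifs with h1 h2
  · rw [← Finset.mul_sum]; ring
  · rfl
  · rfl

lemma hasDerivAt_abs_rpow_of_ne_zero {a : ℝ} (ha : a ≠ 0) (γ : ℝ) :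
    HasDerivAt (fun t : ℝ => |t| ^ γ) (γ * (Real.sign a * |a| ^ (γ - 1))) a := by
  have h := (hasDerivAt_abs ha).rpow_const (p := γ) (Or.inl (abs_ne_zero.2 ha))
  convert! h using 1
  rcases lt_or_gt_of_ne ha with h | h
  · simp [Real.sign_of_neg h, h]
  · simp [Real.sign_of_pos h, h]

lemma tendsto_natCast_rpow_neg {ι : Type*} {l : Filter ι} {φ : ι → ℕ} (hφ : Tendsto φ l atTop)
    {s : ℝ} (hs : s < 0) : Tendsto (fun k => (φ k : ℝ) ^ s) l (𝓝 0) := by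
  have := (tendsto_rpow_neg_atTop (y := -s) (by linarith)).comp
    ((tendsto_natCast_atTop_atTop (R := ℝ)).comp hφ)
  simpa [Function.comp_def] using this

lemma tendsto_sqrt_natCast {ι : Type*} {l : Filter ι} {φ : ι → ℕ} (hφ : Tendsto φ l atTop) :
    Tendsto (fun k => √(φ k : ℝ)) l atTop :=
  Real.tendsto_sqrt_atTop.comp ((tendsto_natCast_atTop_atTop (R := ℝ)).comp hφ)

lemma natCast_rpow_half_mul {n : ℕ} (hn : 1 ≤ n) (γ x : ℝ) :
    (n : ℝ) ^ (γ / 2) * |x / √(n : ℝ)| ^ γ = |x| ^ γ := by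
  have hn' : (0 : ℝ) < n := by exact_mod_cast hn
  rw [abs_div, abs_of_nonneg (Real.sqrt_nonneg _), Real.div_rpow (abs_nonneg _) (Real.sqrt_nonneg _),
    Real.sqrt_eq_rpow, ← Real.rpow_mul hn'.le, show (1 / 2 * γ : ℝ) = γ / 2 by ring]
  field_simp

/-- Coordinatewise continuous convergence of the rescaled penalty. Away from `a = 0` this is
differentiability of `|·| ^ γ`; at `a = 0` it is homogeneity. -/
lemma tendsto_scaled_abs_rpow {ι : Type*} {l : Filter ι} {φ : ι → ℕ} (hφ : Tendsto φ l atTop)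
    {x : ι → ℝ} {x₀ : ℝ} (hx : Tendsto x l (𝓝 x₀)) (a : ℝ) {γ : ℝ} (hγ : 0 < γ) :
    Tendsto (fun k => (φ k : ℝ) ^ (min 1 γ / 2) * (|a + x k / √(φ k : ℝ)| ^ γ - |a| ^ γ)) l
      (𝓝 (coordLimitPenalty a γ x₀)) := by
  have hpos : ∀ᶠ k in l, 1 ≤ φ k := hφ.eventually (eventually_ge_atTop 1)
  have hsq := tendsto_sqrt_natCast hφ
  by_cases ha : a = 0
  · subst ha
    have hpow : Tendsto (fun k => |x k| ^ γ) l (𝓝 (|x₀| ^ γ)) :=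
      (hx.abs).rpow_const (Or.inr hγ.le)
    have key : (fun k => (φ k : ℝ) ^ (min 1 γ / 2 - γ / 2) * |x k| ^ γ) =ᶠ[l]
        (fun k => (φ k : ℝ) ^ (min 1 γ / 2) * (|0 + x k / √(φ k : ℝ)| ^ γ - |(0 : ℝ)| ^ γ)) := by
      filter_upwards [hpos] with k hk
      have hk' : (0 : ℝ) < φ k := by exact_mod_cast hk
      rw [← natCast_rpow_half_mul hk γ (x k), zero_add, abs_zero, Real.zero_rpow hγ.ne', sub_zero,
        ← mul_assoc, ← Real.rpow_add hk']
      congr 2; ring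
    refine Tendsto.congr' key ?_
    unfold coordLimitPenalty
    rcases lt_trichotomy 1 γ with h1 | h1 | h1
    · rw [if_pos h1]
      simpa using (tendsto_natCast_rpow_neg hφ
        (by rw [min_eq_left h1.le]; linarith : min 1 γ / 2 - γ / 2 < 0)).mul hpow
    · subst h1; simpa using hpow
    · rw [if_neg h1.not_gt, if_neg h1.ne, if_pos rfl]
      rw [min_eq_right h1.le]; simpa using hpow
  · have hd := (hasDerivAt_abs_rpow_of_ne_zero ha γ).hasFDerivAt.hasFDerivWithinAt (s := Set.univ)
    have h0 : Tendsto (fun k => x k / √(φ k : ℝ)) l (𝓝 0) := hx.div_atTop hsq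
    have hlim := hd.lim (c := fun k => √(φ k : ℝ)) (d := fun k => x k / √(φ k : ℝ)) (v := x₀) h0
      (by simp) (by
        refine hx.congr' ?_
        filter_upwards [hpos] with k hk
        have hk' : (0 : ℝ) < √(φ k : ℝ) := Real.sqrt_pos.2 (by exact_mod_cast hk)
        simp only [smul_eq_mul]; field_simp)
    simp only [smul_eq_mul, ContinuousLinearMap.toSpanSingleton_apply] at hlim
    unfold coordLimitPenalty
    rcases le_or_gt 1 γ with h1 | h1
    · rw [min_eq_left h1]
      simp only [← Real.sqrt_eq_rpow]
      convert! hlim using 2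
      split_ifs with h2 h3
      · ring
      · subst h3; simp
      · exact absurd (le_antisymm (not_lt.1 h2) h1) h3
    · rw [if_neg (not_lt.2 h1.le), if_neg h1.ne, if_neg ha, min_eq_right h1.le]
      have h3 := (tendsto_natCast_rpow_neg hφ (by linarith : γ / 2 - 1 / 2 < 0)).mul hlim
      rw [zero_mul] at h3
      refine h3.congr' ?_
      filter_upwards [hpos] with k hk
      have hk' : (0 : ℝ) < φ k := by exact_mod_cast hk
      rw [Real.sqrt_eq_rpow, ← mul_assoc, ← Real.rpow_add hk']
      congr 2; ring

lemma abs_abs_rpow_sub_le {γ : ℝ} (hγ : 0 < γ) (hγ1 : γ ≤ 1) (s t : ℝ) :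
    |(|s| ^ γ - |t| ^ γ)| ≤ |s - t| ^ γ := by
  have aux : ∀ s t : ℝ, |s| ^ γ - |t| ^ γ ≤ |s - t| ^ γ := fun s t => by
    have h1 : |s| ^ γ ≤ (|s - t| + |t|) ^ γ :=
      Real.rpow_le_rpow (abs_nonneg _) (by simpa using abs_add_le (s - t) t) hγ.le
    have h2 := Real.rpow_add_le_add_rpow (abs_nonneg (s - t)) (abs_nonneg t) hγ.le hγ1
    linarith
  rw [abs_le]
  refine ⟨?_, aux s t⟩
  have := aux t s
  rw [abs_sub_comm] at this
  linarith

lemma abs_abs_rpow_sub_le_of_one_lt {γ R : ℝ} (hγ : 1 < γ) {s t : ℝ} (hs : |s| ≤ R)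
    (ht : |t| ≤ R) : |(|s| ^ γ - |t| ^ γ)| ≤ γ * R ^ (γ - 1) * |s - t| := by
  have h := (convex_Icc (-R) R).norm_image_sub_le_of_norm_hasDerivWithin_le
    (f := fun x : ℝ => |x| ^ γ) (f' := fun x => γ * |x| ^ (γ - 2) * x) (C := γ * R ^ (γ - 1))
    (fun x _ => (hasDerivAt_abs_rpow x hγ).hasDerivWithinAt) (fun x hx => ?_)
    (abs_le.1 ht) (abs_le.1 hs)
  · simpa using h
  · have hx' : |x| ≤ R := abs_le.2 hx
    rw [Real.norm_eq_abs, abs_mul, abs_mul, abs_of_pos (by linarith : 0 < γ),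
      abs_of_nonneg (Real.rpow_nonneg (abs_nonneg x) _), mul_assoc]
    refine mul_le_mul_of_nonneg_left ?_ (by linarith)
    rcases eq_or_ne x 0 with rfl | hx0
    · simpa using Real.rpow_nonneg ((abs_nonneg _).trans hx') _
    · calc |x| ^ (γ - 2) * |x| = |x| ^ (γ - 1) := by
            rw [← Real.rpow_add_one (abs_ne_zero.2 hx0)]; congr 1; ring
        _ ≤ R ^ (γ - 1) := Real.rpow_le_rpow (abs_nonneg x) hx' (by linarith)

/-- The rescaled penalty grows at most linearly, uniformly in `n`. For `γ > 1` this uses that the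
parameter stays in a bounded set. -/
lemma exists_scaled_abs_rpow_le {γ : ℝ} (hγ : 0 < γ) (R : ℝ) :
    ∃ B : ℝ, 0 ≤ B ∧ ∀ n : ℕ, 1 ≤ n → ∀ a x : ℝ, |a| ≤ R → |a + x / √(n : ℝ)| ≤ R →
      |(n : ℝ) ^ (min 1 γ / 2) * (|a + x / √(n : ℝ)| ^ γ - |a| ^ γ)| ≤ B * (1 + |x|) := by
  rcases le_or_gt γ 1 with h1 | h1
  · refine ⟨1, zero_le_one, fun n hn a x _ _ => ?_⟩
    rw [min_eq_right h1, abs_mul, abs_of_nonneg (Real.rpow_nonneg (Nat.cast_nonneg n) _), one_mul]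
    calc _ ≤ (n : ℝ) ^ (γ / 2) * |x / √(n : ℝ)| ^ γ := by
          gcongr
          simpa using abs_abs_rpow_sub_le hγ h1 (a + x / √(n : ℝ)) a
      _ = |x| ^ γ := natCast_rpow_half_mul hn γ x
      _ ≤ (1 + |x|) ^ γ := Real.rpow_le_rpow (abs_nonneg _) (by linarith) hγ.le
      _ ≤ (1 + |x|) ^ (1 : ℝ) :=
          Real.rpow_le_rpow_of_exponent_le (by linarith [abs_nonneg x]) h1
      _ = 1 + |x| := Real.rpow_one _
  · refine ⟨γ * |R| ^ (γ - 1), by positivity, fun n hn a x ha hx => ?_⟩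
    have hR : 0 ≤ R := (abs_nonneg _).trans ha
    have hn' : 0 < √(n : ℝ) := Real.sqrt_pos.2 (by exact_mod_cast hn)
    rw [min_eq_left h1.le, abs_mul, ← Real.sqrt_eq_rpow, abs_of_pos hn', abs_of_nonneg hR]
    calc _ ≤ √(n : ℝ) * (γ * R ^ (γ - 1) * |x / √(n : ℝ)|) := by
          gcongr
          simpa using abs_abs_rpow_sub_le_of_one_lt h1 hx ha
      _ = γ * R ^ (γ - 1) * |x| := by
          rw [abs_div, abs_of_pos hn']; field_simp
      _ ≤ _ := by gcongr; linarith

/-- The increment of the penalty `lam * ∑ |θ j| ^ γ` between `θ₀` and `θ₀ + u / √n`. -/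
noncomputable def penaltyIncrement {p : ℕ} (n : ℕ) (θ₀ : EuclideanSpace ℝ (Fin p)) (lam γ : ℝ)
    (u : EuclideanSpace ℝ (Fin p)) : ℝ :=
  lam * ∑ j, (|θ₀ j + u j / √(n : ℝ)| ^ γ - |θ₀ j| ^ γ)

lemma penaltyIncrement_eq {p : ℕ} {n : ℕ} (hn : 1 ≤ n) (θ₀ : EuclideanSpace ℝ (Fin p))
    (lam γ : ℝ) (u : EuclideanSpace ℝ (Fin p)) :
    penaltyIncrement n θ₀ lam γ u = lam / (n : ℝ) ^ (min 1 γ / 2) *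
      ∑ j, (n : ℝ) ^ (min 1 γ / 2) * (|θ₀ j + u j / √(n : ℝ)| ^ γ - |θ₀ j| ^ γ) := by
  have hn' : (0 : ℝ) < (n : ℝ) ^ (min 1 γ / 2) := Real.rpow_pos_of_pos (by exact_mod_cast hn) _
  rw [penaltyIncrement, ← Finset.mul_sum, ← mul_assoc, div_mul_cancel₀ _ hn'.ne']

lemma tendsto_penaltyIncrement {p : ℕ} {ι : Type*} {l : Filter ι} {φ : ι → ℕ}
    (hφ : Tendsto φ l atTop) {u : ι → EuclideanSpace ℝ (Fin p)} {u₀ : EuclideanSpace ℝ (Fin p)}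
    (hu : Tendsto u l (𝓝 u₀)) (θ₀ : EuclideanSpace ℝ (Fin p)) {γ : ℝ} (hγ : 0 < γ)
    {lam : ℕ → ℝ} {lam₀ : ℝ}
    (hlam : Tendsto (fun n : ℕ => lam n / (n : ℝ) ^ (min 1 γ / 2)) atTop (𝓝 lam₀)) :
    Tendsto (fun k => penaltyIncrement (φ k) θ₀ (lam (φ k)) γ (u k)) l
      (𝓝 (limitPenalty θ₀ γ lam₀ u₀)) := by
  rw [limitPenalty_eq_sum]
  have h := (hlam.comp hφ).mul (tendsto_finsetSum Finset.univ fun j _ =>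
    tendsto_scaled_abs_rpow hφ
      (((continuous_apply j).comp (PiLp.continuous_ofLp 2 _)).tendsto u₀ |>.comp hu) (θ₀ j) hγ)
  refine h.congr' ?_
  filter_upwards [hφ.eventually (eventually_ge_atTop 1)] with k hk
  rw [penaltyIncrement_eq hk]
  rfl

lemma exists_abs_penaltyIncrement_le {p : ℕ} {Θ : Set (EuclideanSpace ℝ (Fin p))}
    (hΘ : IsCompact Θ) {θ₀ : EuclideanSpace ℝ (Fin p)} (hθ₀ : θ₀ ∈ Θ) {γ : ℝ} (hγ : 0 < γ)
    {lam : ℕ → ℝ} {lam₀ : ℝ}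
    (hlam : Tendsto (fun n : ℕ => lam n / (n : ℝ) ^ (min 1 γ / 2)) atTop (𝓝 lam₀)) :
    ∃ B : ℝ, 0 ≤ B ∧ ∀ n : ℕ, 1 ≤ n → ∀ u, θ₀ + (√(n : ℝ))⁻¹ • u ∈ Θ →
      |penaltyIncrement n θ₀ (lam n) γ u| ≤ B * (1 + ‖u‖) := by
  obtain ⟨R, hR⟩ := hΘ.isBounded.exists_norm_le
  obtain ⟨B, hB0, hB⟩ := exists_scaled_abs_rpow_le hγ R
  obtain ⟨Λ, hΛ⟩ := (Metric.isBounded_range_of_tendsto _ hlam).exists_norm_le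
  have hΛ0 : 0 ≤ Λ := (norm_nonneg _).trans (hΛ _ ⟨0, rfl⟩)
  refine ⟨Λ * (p * B), by positivity, fun n hn u hu => ?_⟩
  rw [penaltyIncrement_eq hn, abs_mul]
  have h1 : |lam n / (n : ℝ) ^ (min 1 γ / 2)| ≤ Λ := hΛ _ ⟨n, rfl⟩
  have hcoord : ∀ (v : EuclideanSpace ℝ (Fin p)) j, |v j| ≤ ‖v‖ := fun v j =>
    PiLp.norm_apply_le v j
  calc _ ≤ Λ * ∑ j : Fin p, B * (1 + ‖u‖) := by
        refine mul_le_mul h1 ((Finset.abs_sum_le_sum_abs _ _).trans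
          (Finset.sum_le_sum fun j _ => ?_)) (abs_nonneg _) hΛ0
        refine (hB n hn (θ₀ j) (u j) ((hcoord _ j).trans (hR _ hθ₀)) ?_).trans ?_
        · have := (hcoord _ j).trans (hR _ hu)
          simpa [div_eq_inv_mul] using this
        · gcongr; exact hcoord u j
    _ = _ := by simp; ring

lemma continuous_limitPenalty {p : ℕ} (θ₀ : EuclideanSpace ℝ (Fin p)) {γ : ℝ} (hγ : 0 < γ)
    (lam₀ : ℝ) : Continuous (limitPenalty θ₀ γ lam₀) := by
  unfold limitPenalty
  split_ifs with h1 h2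
  · fun_prop
  · refine continuous_const.mul (continuous_finsetSum _ fun j _ => ?_)
    split_ifs <;> fun_prop
  · refine continuous_const.mul (continuous_finsetSum _ fun j _ => ?_)
    split_ifs
    · exact Continuous.rpow_const (by fun_prop) fun _ => Or.inr hγ.le
    · fun_prop

/-! ### Quadratic forms and the Gram matrix -/

lemma abs_dotProduct_mulVec_le {p : ℕ} (A : Matrix (Fin p) (Fin p) ℝ)
    (u : EuclideanSpace ℝ (Fin p)) : |u.ofLp ⬝ᵥ (A *ᵥ u.ofLp)| ≤ ‖A‖ * ‖u‖ ^ 2 := by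
  have h1 : ‖WithLp.toLp 2 (A *ᵥ u.ofLp)‖ ≤ ‖A‖ * ‖u‖ := by
    have := Matrix.frobenius_norm_mul A (Matrix.replicateCol Unit u.ofLp)
    rwa [← Matrix.replicateCol_mulVec, Matrix.frobenius_norm_replicateCol,
      Matrix.frobenius_norm_replicateCol] at this
  have h2 : u.ofLp ⬝ᵥ (A *ᵥ u.ofLp) = inner ℝ (WithLp.toLp 2 (A *ᵥ u.ofLp)) u := by
    simp [EuclideanSpace.inner_eq_star_dotProduct]
  rw [h2]
  calc _ ≤ ‖WithLp.toLp 2 (A *ᵥ u.ofLp)‖ * ‖u‖ := abs_real_inner_le_norm _ _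
    _ ≤ ‖A‖ * ‖u‖ * ‖u‖ := by gcongr
    _ = _ := by ring

lemma Matrix.PosDef.exists_mul_norm_sq_le {p : ℕ} {C : Matrix (Fin p) (Fin p) ℝ}
    (hC : C.PosDef) :
    ∃ c : ℝ, 0 < c ∧ ∀ u : EuclideanSpace ℝ (Fin p), c * ‖u‖ ^ 2 ≤ u.ofLp ⬝ᵥ (C *ᵥ u.ofLp) := by
  have hcont : Continuous fun u : EuclideanSpace ℝ (Fin p) => u.ofLp ⬝ᵥ (C *ᵥ u.ofLp) := by
    fun_prop
  obtain ⟨c, hc0, hc⟩ := (isCompact_sphere (0 : EuclideanSpace ℝ (Fin p)) 1).exists_forall_le'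
    hcont.continuousOn (a := 0) (fun u hu => by
      have hu0 : u.ofLp ≠ 0 := by
        intro h
        have : u = 0 := by ext j; simp [h]
        simp [this] at hu
      simpa using hC.dotProduct_mulVec_pos hu0)
  refine ⟨c, hc0, fun u => ?_⟩
  rcases eq_or_ne u 0 with rfl | hu
  · simp
  have hn : ‖u‖ ≠ 0 := norm_ne_zero_iff.2 hu
  have h := hc (‖u‖⁻¹ • u) (by simp [norm_smul, hn])
  simp only [WithLp.ofLp_smul, Matrix.mulVec_smul, dotProduct_smul, smul_dotProduct,
    smul_eq_mul] at h
  calc c * ‖u‖ ^ 2 ≤ (‖u‖⁻¹ * (‖u‖⁻¹ * (u.ofLp ⬝ᵥ (C *ᵥ u.ofLp)))) * ‖u‖ ^ 2 := by gcongr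
    _ = _ := by field_simp

lemma tendsto_gramMean {p : ℕ} {X : ℕ → ℕ → EuclideanSpace ℝ (Fin p)} {δ : ℝ} (hδ : 0 < δ)
    {C₀ : Matrix (Fin p) (Fin p) ℝ}
    (hC : ∃ K : ℝ, ∀ n : ℕ, 1 ≤ n → (n : ℝ) ^ δ * ‖gramMean n (X n) - C₀‖ ≤ K) :
    Tendsto (fun n => gramMean n (X n)) atTop (𝓝 C₀) := by
  obtain ⟨K, hK⟩ := hC
  refine tendsto_iff_norm_sub_tendsto_zero.2 ?_
  have h0 : Tendsto (fun n : ℕ => K * (n : ℝ) ^ (-δ)) atTop (𝓝 0) := by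
    simpa using (tendsto_natCast_rpow_neg tendsto_id (neg_lt_zero.2 hδ)).const_mul K
  refine squeeze_zero' (Eventually.of_forall fun _ => norm_nonneg _) ?_ h0
  filter_upwards [eventually_ge_atTop 1] with n hn
  have hn' : (0 : ℝ) < (n : ℝ) ^ δ := Real.rpow_pos_of_pos (by exact_mod_cast hn) _
  rw [Real.rpow_neg (Nat.cast_nonneg n), ← div_eq_mul_inv, le_div_iff₀ hn', mul_comm]
  exact hK n hn

lemma dotProduct_gramMean_mulVec {p : ℕ} (n : ℕ) (X : ℕ → EuclideanSpace ℝ (Fin p))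
    (u : EuclideanSpace ℝ (Fin p)) :
    u.ofLp ⬝ᵥ (gramMean n X *ᵥ u.ofLp) =
      (n : ℝ)⁻¹ * ∑ i ∈ Finset.range n, (inner ℝ u (X i)) ^ 2 := by
  simp only [gramMean, Matrix.smul_mulVec, dotProduct_smul, smul_eq_mul, Matrix.sum_mulVec,
    dotProduct_sum]
  congr 1
  refine Finset.sum_congr rfl fun i _ => ?_
  simp only [Matrix.vecMulVec_mulVec, EuclideanSpace.inner_eq_star_dotProduct, star_trivial]
  rw [dotProduct_smul]
  simp [dotProduct_comm, sq]

/-! ### The local random field -/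

/-- The normalized score `n ^ (-1/2) ∑ e i X i` of the least squares contrast. -/
noncomputable def normalizedScore {p : ℕ} (n : ℕ) (X : ℕ → EuclideanSpace ℝ (Fin p))
    (e : ℕ → ℝ) : EuclideanSpace ℝ (Fin p) :=
  (√(n : ℝ))⁻¹ • ∑ i ∈ Finset.range n, e i • X i

/-- The field `u ↦ -2 sᵀ u + g u`: a deterministic function `g` tilted by the (random) score. -/
noncomputable def tiltedField {p : ℕ} (g : EuclideanSpace ℝ (Fin p) → ℝ)
    (s u : EuclideanSpace ℝ (Fin p)) : ℝ :=
  -2 * inner ℝ s u + g u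

/-- The deterministic part of the local contrast `u ↦ Z_n(θ₀ + u / √n) - Z_n(θ₀)`. -/
noncomputable def localDrift {p : ℕ} (n : ℕ) (X : ℕ → EuclideanSpace ℝ (Fin p))
    (θ₀ : EuclideanSpace ℝ (Fin p)) (lam γ : ℝ) (u : EuclideanSpace ℝ (Fin p)) : ℝ :=
  u.ofLp ⬝ᵥ (gramMean n X *ᵥ u.ofLp) + penaltyIncrement n θ₀ lam γ u

/-- The deterministic part of the limit field. -/
noncomputable def limitDrift {p : ℕ} (C₀ : Matrix (Fin p) (Fin p) ℝ)
    (θ₀ : EuclideanSpace ℝ (Fin p)) (γ lam₀ : ℝ) (u : EuclideanSpace ℝ (Fin p)) : ℝ :=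
  u.ofLp ⬝ᵥ (C₀ *ᵥ u.ofLp) + limitPenalty θ₀ γ lam₀ u

lemma limitField_eq_tiltedField {p : ℕ} (C₀ : Matrix (Fin p) (Fin p) ℝ)
    (θ₀ : EuclideanSpace ℝ (Fin p)) (γ lam₀ : ℝ) :
    limitField C₀ θ₀ γ lam₀ = tiltedField (limitDrift C₀ θ₀ γ lam₀) := by
  ext w u
  simp only [limitField, tiltedField, limitDrift]
  ring

lemma bridgeContrast_sub_eq_tiltedField {p n : ℕ} (hn : 1 ≤ n)
    {X : ℕ → EuclideanSpace ℝ (Fin p)} {Y e : ℕ → ℝ} {θ₀ : EuclideanSpace ℝ (Fin p)}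
    (hY : ∀ i < n, Y i = inner ℝ θ₀ (X i) + e i) (lam γ : ℝ) (u : EuclideanSpace ℝ (Fin p)) :
    bridgeContrast n X Y lam γ (θ₀ + (√(n : ℝ))⁻¹ • u) - bridgeContrast n X Y lam γ θ₀ =
      tiltedField (localDrift n X θ₀ lam γ) (normalizedScore n X e) u := by
  have hn0 : (0 : ℝ) < n := by exact_mod_cast hn
  have hinv : (n : ℝ)⁻¹ = (√(n : ℝ))⁻¹ ^ 2 := by rw [inv_pow, Real.sq_sqrt hn0.le]
  simp only [bridgeContrast, tiltedField, localDrift, dotProduct_gramMean_mulVec,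
    penaltyIncrement, normalizedScore, inner_smul_left, sum_inner, hinv]
  have h1 : ∀ i ∈ Finset.range n, (Y i - inner ℝ (θ₀ + (√(n : ℝ))⁻¹ • u) (X i)) ^ 2 =
      (Y i - inner ℝ θ₀ (X i)) ^ 2 - 2 * (√(n : ℝ))⁻¹ * (e i * inner ℝ (X i) u) +
        (√(n : ℝ))⁻¹ ^ 2 * (inner ℝ u (X i)) ^ 2 := by
    intro i hi
    rw [hY i (Finset.mem_range.1 hi), inner_add_left, inner_smul_left, real_inner_comm u (X i)]
    simp only [RCLike.conj_to_real]
    ring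
  rw [Finset.sum_congr rfl h1, Finset.sum_add_distrib, Finset.sum_sub_distrib, ← Finset.mul_sum,
    ← Finset.mul_sum, Finset.sum_sub_distrib]
  simp only [RCLike.conj_to_real, PiLp.add_apply, PiLp.smul_apply, smul_eq_mul, div_eq_inv_mul]
  ring

/-! ### Coercivity -/

/-- A field that is nonpositive at `u` and dominates a quadratic minus a linear term forces `u`
to be at most of the order of the score. -/
lemma norm_le_of_tiltedField_nonpos {p : ℕ} {g : EuclideanSpace ℝ (Fin p) → ℝ} {c B : ℝ}
    (hc : 0 < c) (hB : 0 ≤ B) {s u : EuclideanSpace ℝ (Fin p)}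
    (hg : c * ‖u‖ ^ 2 - B * (1 + ‖u‖) ≤ g u) (hs : tiltedField g s u ≤ 0) :
    ‖u‖ ≤ (1 + (2 + 2 * B) / c) * (1 + ‖s‖) := by
  have hin : inner ℝ s u ≤ ‖s‖ * ‖u‖ := real_inner_le_norm s u
  unfold tiltedField at hs
  have hns := norm_nonneg s
  have hq : 0 ≤ (2 + 2 * B) / c := by positivity
  rcases le_or_gt ‖u‖ 1 with h | h
  · nlinarith [mul_nonneg hq hns]
  · have h2 : c * ‖u‖ ≤ 2 * ‖s‖ + 2 * B := by
      by_contra! hcon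
      nlinarith
    have h3 : ‖u‖ ≤ (2 * ‖s‖ + 2 * B) / c := by
      rw [le_div_iff₀ hc]; linarith
    have h4 : (2 * ‖s‖ + 2 * B) / c ≤ (2 + 2 * B) / c * (1 + ‖s‖) := by
      rw [div_mul_eq_mul_div]
      gcongr
      nlinarith
    nlinarith [mul_nonneg hq hns]

lemma tiltedField_zero {p : ℕ} {g : EuclideanSpace ℝ (Fin p) → ℝ} (hg : g 0 = 0)
    (s : EuclideanSpace ℝ (Fin p)) : tiltedField g s 0 = 0 := by
  simp [tiltedField, hg]

lemma exists_isMinOn_tiltedField {p : ℕ} {g : EuclideanSpace ℝ (Fin p) → ℝ} {A : ℝ}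
    (hcont : Continuous g) (h0 : g 0 = 0)
    (hA : ∀ s u, tiltedField g s u ≤ 0 → ‖u‖ ≤ A * (1 + ‖s‖)) (s : EuclideanSpace ℝ (Fin p)) :
    ∃ u, IsMinOn (tiltedField g s) Set.univ u := by
  have hc : Continuous (tiltedField g s) := by unfold tiltedField; fun_prop
  have h0' := tiltedField_zero h0 s
  have hAs : 0 ≤ A * (1 + ‖s‖) := by simpa using hA s 0 h0'.le
  obtain ⟨u, -, hu⟩ := (isCompact_closedBall (0 : EuclideanSpace ℝ (Fin p))
    (A * (1 + ‖s‖))).exists_isMinOn ⟨0, by simpa using hAs⟩ hc.continuousOn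
  refine ⟨u, fun v _ => ?_⟩
  rcases le_or_gt (tiltedField g s v) 0 with hv | hv
  · exact hu (by simpa using hA s v hv)
  · have : tiltedField g s u ≤ tiltedField g s 0 := hu (by simpa using hAs)
    exact (this.trans h0'.le).trans hv.le

/-! ### Stability of minimizers -/

/-- Continuity of the argmin: minimizers over `U n` of the tilted fields converge to the unique
minimizer of the limit field, as soon as the drifts converge continuously, the sets `U n` exhaust
the space and the minimizers stay bounded. -/
lemma tendsto_argmin_tiltedField {p : ℕ} {G : ℕ → EuclideanSpace ℝ (Fin p) → ℝ}
    {g : EuclideanSpace ℝ (Fin p) → ℝ} {U : ℕ → Set (EuclideanSpace ℝ (Fin p))} {A : ℝ}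
    (hU : ∀ v, ∀ᶠ n in atTop, v ∈ U n)
    (hG : ∀ (φ : ℕ → ℕ) (x : ℕ → EuclideanSpace ℝ (Fin p)) (x₀ : EuclideanSpace ℝ (Fin p)),
      Tendsto φ atTop atTop → Tendsto x atTop (𝓝 x₀) →
        Tendsto (fun k => G (φ k) (x k)) atTop (𝓝 (g x₀)))
    (hG0 : ∀ n, G n 0 = 0)
    (hA : ∀ᶠ n in atTop, ∀ s, ∀ u ∈ U n, tiltedField (G n) s u ≤ 0 → ‖u‖ ≤ A * (1 + ‖s‖))
    {φ : ℕ → ℕ} (hφ : Tendsto φ atTop atTop) {s u : ℕ → EuclideanSpace ℝ (Fin p)}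
    {s₀ u₀ : EuclideanSpace ℝ (Fin p)} (hs : Tendsto s atTop (𝓝 s₀))
    (hu : ∀ k, u k ∈ U (φ k) ∧ IsMinOn (tiltedField (G (φ k)) (s k)) (U (φ k)) (u k))
    (huniq : ∀ v, IsMinOn (tiltedField g s₀) Set.univ v → v = u₀) :
    Tendsto u atTop (𝓝 u₀) := by
  have htilt : ∀ (φ : ℕ → ℕ) (s x : ℕ → EuclideanSpace ℝ (Fin p))
      (s₀ x₀ : EuclideanSpace ℝ (Fin p)), Tendsto φ atTop atTop → Tendsto s atTop (𝓝 s₀) →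
      Tendsto x atTop (𝓝 x₀) →
      Tendsto (fun k => tiltedField (G (φ k)) (s k) (x k)) atTop (𝓝 (tiltedField g s₀ x₀)) :=
    fun φ s x s₀ x₀ h1 h2 h3 => ((h2.inner h3).const_mul (-2)).add (hG φ x x₀ h1 h3)
  refine tendsto_of_subseq_tendsto fun ns hns => ?_
  obtain ⟨M, hM⟩ := (Metric.isBounded_range_of_tendsto _ hs).exists_norm_le
  have hev : ∀ᶠ k in atTop, ‖u (ns k)‖ ≤ |A| * (1 + M) := by
    filter_upwards [(hφ.comp hns).eventually hA, (hφ.comp hns).eventually (hU 0)] with k hk hk0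
    have h1 : tiltedField (G (φ (ns k))) (s (ns k)) (u (ns k)) ≤ 0 :=
      ((hu (ns k)).2 hk0).trans (tiltedField_zero (hG0 _) _).le
    calc _ ≤ A * (1 + ‖s (ns k)‖) := hk _ _ (hu (ns k)).1 h1
      _ ≤ |A| * (1 + M) := by
        gcongr
        · exact le_abs_self A
        · exact hM _ ⟨_, rfl⟩
  obtain ⟨N, hN⟩ := eventually_atTop.1 hev
  obtain ⟨v, -, ψ, hψ, hv⟩ := tendsto_subseq_of_bounded
    (Metric.isBounded_closedBall (x := (0 : EuclideanSpace ℝ (Fin p))) (r := |A| * (1 + M)))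
    (x := fun k => u (ns (k + N))) (fun k => by simpa using hN (k + N) (Nat.le_add_left N k))
  refine ⟨fun k => ψ k + N, ?_⟩
  have hidx : Tendsto (fun k => ns (ψ k + N)) atTop atTop :=
    hns.comp ((tendsto_add_atTop_nat N).comp hψ.tendsto_atTop)
  have hφ' : Tendsto (fun k => φ (ns (ψ k + N))) atTop atTop := hφ.comp hidx
  have hs' := hs.comp hidx
  have hv' : Tendsto (fun k => u (ns (ψ k + N))) atTop (𝓝 v) := hv
  suffices v = u₀ by rwa [← this]
  refine huniq v fun w _ => ?_
  refine le_of_tendsto_of_tendsto (htilt _ _ _ _ _ hφ' hs' hv')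
    (htilt _ _ _ _ _ hφ' hs' (tendsto_const_nhds (x := w))) ?_
  filter_upwards [hφ'.eventually (hU w)] with k hk
  exact (hu _).2 hk

/-! ### Absolute continuity of nondegenerate Gaussian measures -/

lemma MeasureTheory.Measure.AbsolutelyContinuous.pi_fin {n : ℕ} {μ ν : Fin n → Measure ℝ}
    [∀ i, SigmaFinite (μ i)] [∀ i, SigmaFinite (ν i)] (h : ∀ i, μ i ≪ ν i) :
    Measure.pi μ ≪ Measure.pi ν := by
  induction n with
  | zero =>
    rw [Measure.pi_of_empty μ, Measure.pi_of_empty ν]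
  | succ n ih =>
    rw [← ((measurePreserving_piFinSuccAbove μ 0).symm).map_eq,
      ← ((measurePreserving_piFinSuccAbove ν 0).symm).map_eq]
    exact ((h 0).prod (ih fun j => h _)).map (MeasurableEquiv.measurable _)

lemma stdGaussian_absolutelyContinuous (p : ℕ) :
    stdGaussian (EuclideanSpace ℝ (Fin p)) ≪ volume := by
  rw [← map_pi_eq_stdGaussian,
    ← ((EuclideanSpace.volume_preserving_symm_measurableEquiv_toLp (Fin p)).symm).map_eq]
  refine Measure.AbsolutelyContinuous.map ?_ (MeasurableEquiv.toLp 2 (Fin p → ℝ)).measurable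
  exact Measure.AbsolutelyContinuous.pi_fin fun _ => gaussianReal_absolutelyContinuous 0 one_ne_zero

open scoped MatrixOrder in
lemma multivariateGaussian_absolutelyContinuous {p : ℕ} {S : Matrix (Fin p) (Fin p) ℝ}
    (hS : S.PosDef) : multivariateGaussian 0 S ≪ volume := by
  have hdet : LinearMap.det ((Matrix.toEuclideanCLM (𝕜 := ℝ) (CFC.sqrt S) :
      EuclideanSpace ℝ (Fin p) →L[ℝ] EuclideanSpace ℝ (Fin p)) :
      EuclideanSpace ℝ (Fin p) →ₗ[ℝ] EuclideanSpace ℝ (Fin p)) ≠ 0 := by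
    have h2 : IsUnit (CFC.sqrt S) := by
      have h := CFC.sqrt_mul_sqrt_self S hS.posSemidef.nonneg
      have hu : IsUnit (CFC.sqrt S * CFC.sqrt S) := by rw [h]; exact hS.isUnit
      rw [Matrix.isUnit_iff_isUnit_det, Matrix.det_mul] at hu
      rw [Matrix.isUnit_iff_isUnit_det]
      exact isUnit_of_mul_isUnit_left hu
    have h3 := h2.map (Matrix.toEuclideanCLM (n := Fin p) (𝕜 := ℝ))
    obtain ⟨g, hg⟩ := h3.exists_right_inv
    have h4 := congrArg (fun L : EuclideanSpace ℝ (Fin p) →L[ℝ] EuclideanSpace ℝ (Fin p) =>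
      LinearMap.det (L : EuclideanSpace ℝ (Fin p) →ₗ[ℝ] EuclideanSpace ℝ (Fin p))) hg
    simp only [ContinuousLinearMap.toLinearMap_mul, map_mul, ContinuousLinearMap.toLinearMap_one,
      map_one] at h4
    exact left_ne_zero_of_mul_eq_one h4
  refine Measure.AbsolutelyContinuous.mk fun s hs h0 => ?_
  rw [multivariateGaussian, Measure.map_apply (by fun_prop) hs]
  apply stdGaussian_absolutelyContinuous p
  simp only [zero_add]
  rw [Measure.addHaar_preimage_continuousLinearMap _ hdet, h0, mul_zero]

/-! ### Uniqueness of the minimizer of the limit field -/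

/-- For almost every tilt the tilted field has at most one minimizer. The value function
`w ↦ min (tiltedField g w)` is an infimum of affine functions of `w`; it is locally Lipschitz, hence
almost everywhere differentiable by Rademacher's theorem, and at a point of differentiability every
minimizer `u` satisfies `-2 u = ∇ value`. -/
lemma ae_unique_isMinOn_tiltedField {p : ℕ} {g : EuclideanSpace ℝ (Fin p) → ℝ} {A : ℝ}
    (hcont : Continuous g) (h0 : g 0 = 0)
    (hA : ∀ s u, tiltedField g s u ≤ 0 → ‖u‖ ≤ A * (1 + ‖s‖)) :
    ∀ᵐ w : EuclideanSpace ℝ (Fin p), ∀ u v, IsMinOn (tiltedField g w) Set.univ u →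
      IsMinOn (tiltedField g w) Set.univ v → u = v := by
  choose m hm using exists_isMinOn_tiltedField hcont h0 hA
  have hle : ∀ w w', tiltedField g w (m w) ≤ tiltedField g w (m w') := fun w w' =>
    hm w (Set.mem_univ _)
  have hmA : ∀ w, ‖m w‖ ≤ |A| * (1 + ‖w‖) := fun w =>
    (hA w _ ((hm w (Set.mem_univ 0)).trans (tiltedField_zero h0 w).le)).trans
      (by gcongr; exact le_abs_self A)
  have hlip : ∀ R : ℕ, LipschitzOnWith (2 * (|A| * (1 + R))).toNNReal
      (fun w => tiltedField g w (m w)) (Metric.ball 0 (R : ℝ)) := by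
    refine fun R => LipschitzOnWith.of_le_add_mul _ fun w _ w' hw' => ?_
    rw [Real.coe_toNNReal _ (by positivity)]
    refine (hle w w').trans ?_
    have h1 : tiltedField g w (m w') =
        tiltedField g w' (m w') - 2 * inner ℝ (w - w') (m w') := by
      simp only [tiltedField, inner_sub_left]; ring
    have h2 := abs_le.1 (abs_real_inner_le_norm (w - w') (m w'))
    have h3 : ‖m w'‖ ≤ |A| * (1 + R) := by
      refine (hmA w').trans ?_
      gcongr
      exact (by simpa using hw' : ‖w'‖ < R).le
    have h4 := mul_le_mul_of_nonneg_left h3 (norm_nonneg (w - w'))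
    rw [h1, dist_eq_norm]
    nlinarith [h2.1]
  have hae : ∀ᵐ w : EuclideanSpace ℝ (Fin p), ∀ R : ℕ, w ∈ Metric.ball (0 : EuclideanSpace ℝ (Fin p))
      (R : ℝ) → DifferentiableWithinAt ℝ (fun w => tiltedField g w (m w))
        (Metric.ball 0 (R : ℝ)) w :=
    ae_all_iff.2 fun R => (hlip R).ae_differentiableWithinAt_of_mem
  filter_upwards [hae] with w hw u v hu hv
  obtain ⟨R, hR⟩ := exists_nat_gt ‖w‖
  have hwR : w ∈ Metric.ball (0 : EuclideanSpace ℝ (Fin p)) (R : ℝ) := by simpa using hR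
  have hd := ((hw R hwR).differentiableAt (Metric.isOpen_ball.mem_nhds hwR)).hasFDerivAt
  have hgrad : ∀ u, IsMinOn (tiltedField g w) Set.univ u →
      fderiv ℝ (fun w => tiltedField g w (m w)) w = (-2 : ℝ) • innerSL ℝ u := by
    intro u hu
    -- the affine function `w' ↦ tiltedField g w' u` touches the value function from above at `w`
    have haff : HasFDerivAt (fun w' => tiltedField g w' u) ((-2 : ℝ) • innerSL ℝ u) w := by
      have := (((innerSL ℝ u).hasFDerivAt (x := w)).const_mul (-2)).add_const (g u)
      refine this.congr_of_eventuallyEq (Eventually.of_forall fun w' => ?_)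
      simp [tiltedField, real_inner_comm]
    have hmin : IsLocalMin (fun w' => tiltedField g w' u - tiltedField g w' (m w')) w := by
      refine Eventually.of_forall fun w' => ?_
      have h1 : tiltedField g w u ≤ tiltedField g w (m w) := hu (Set.mem_univ _)
      have h2 : tiltedField g w' (m w') ≤ tiltedField g w' u := hm w' (Set.mem_univ _)
      change tiltedField g w u - tiltedField g w (m w) ≤
        tiltedField g w' u - tiltedField g w' (m w')
      linarith
    exact (sub_eq_zero.1 (hmin.hasFDerivAt_eq_zero (haff.sub hd))).symm
  have h := (hgrad u hu).symm.trans (hgrad v hv)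
  refine ext_inner_right ℝ fun z => ?_
  have hz := congrArg (fun L => L z) h
  simpa using hz

lemma exists_abs_coordLimitPenalty_le {γ : ℝ} (hγ : 0 < γ) (R : ℝ) :
    ∃ B : ℝ, 0 ≤ B ∧ ∀ a x : ℝ, |a| ≤ R → |coordLimitPenalty a γ x| ≤ B * (1 + |x|) := by
  obtain ⟨B, hB0, hB⟩ := exists_scaled_abs_rpow_le hγ (R + 1)
  refine ⟨B, hB0, fun a x ha => ?_⟩
  have h1 : Tendsto (fun n : ℕ => |a + x / √(n : ℝ)|) atTop (𝓝 |a|) := by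
    have : Tendsto (fun n : ℕ => x / √(n : ℝ)) atTop (𝓝 0) :=
      tendsto_const_nhds.div_atTop (tendsto_sqrt_natCast tendsto_id)
    simpa using (this.const_add a).abs
  refine le_of_tendsto (tendsto_scaled_abs_rpow tendsto_id (tendsto_const_nhds (x := x)) a hγ).abs ?_
  filter_upwards [eventually_ge_atTop 1,
    h1.eventually (eventually_le_nhds (by linarith : |a| < R + 1))] with n hn hn'
  exact hB n hn a x (by linarith) hn'

lemma exists_abs_limitPenalty_le {p : ℕ} (θ₀ : EuclideanSpace ℝ (Fin p)) {γ : ℝ} (hγ : 0 < γ)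
    (lam₀ : ℝ) :
    ∃ B : ℝ, 0 ≤ B ∧ ∀ u, |limitPenalty θ₀ γ lam₀ u| ≤ B * (1 + ‖u‖) := by
  obtain ⟨B, hB0, hB⟩ := exists_abs_coordLimitPenalty_le hγ ‖θ₀‖
  refine ⟨|lam₀| * (p * B), by positivity, fun u => ?_⟩
  rw [limitPenalty_eq_sum, abs_mul]
  calc _ ≤ |lam₀| * ∑ j : Fin p, B * (1 + ‖u‖) := by
        refine mul_le_mul_of_nonneg_left ((Finset.abs_sum_le_sum_abs _ _).trans
          (Finset.sum_le_sum fun j _ => ?_)) (abs_nonneg _)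
        refine (hB (θ₀ j) (u j) (PiLp.norm_apply_le θ₀ j)).trans ?_
        gcongr
        exact PiLp.norm_apply_le u j
    _ = _ := by simp; ring

lemma coordLimitPenalty_zero (a : ℝ) {γ : ℝ} (hγ : 0 < γ) : coordLimitPenalty a γ 0 = 0 := by
  simp [coordLimitPenalty, Real.zero_rpow hγ.ne']

lemma limitDrift_zero {p : ℕ} (C₀ : Matrix (Fin p) (Fin p) ℝ) (θ₀ : EuclideanSpace ℝ (Fin p))
    {γ : ℝ} (hγ : 0 < γ) (lam₀ : ℝ) : limitDrift C₀ θ₀ γ lam₀ 0 = 0 := by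
  simp [limitDrift, limitPenalty_eq_sum, coordLimitPenalty_zero _ hγ]

lemma continuous_limitDrift {p : ℕ} (C₀ : Matrix (Fin p) (Fin p) ℝ)
    (θ₀ : EuclideanSpace ℝ (Fin p)) {γ : ℝ} (hγ : 0 < γ) (lam₀ : ℝ) :
    Continuous (limitDrift C₀ θ₀ γ lam₀) := by
  unfold limitDrift
  have := continuous_limitPenalty θ₀ hγ lam₀
  fun_prop

lemma exists_norm_le_of_limitDrift {p : ℕ} {C₀ : Matrix (Fin p) (Fin p) ℝ} (hC₀ : C₀.PosDef)
    (θ₀ : EuclideanSpace ℝ (Fin p)) {γ : ℝ} (hγ : 0 < γ) (lam₀ : ℝ) :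
    ∃ A : ℝ, ∀ s u, tiltedField (limitDrift C₀ θ₀ γ lam₀) s u ≤ 0 → ‖u‖ ≤ A * (1 + ‖s‖) := by
  obtain ⟨c, hc, hq⟩ := hC₀.exists_mul_norm_sq_le
  obtain ⟨B, hB, hpen⟩ := exists_abs_limitPenalty_le θ₀ hγ lam₀
  refine ⟨_, fun s u h => norm_le_of_tiltedField_nonpos hc hB ?_ h⟩
  have h1 := hq u
  have h2 := (abs_le.1 (hpen u)).1
  unfold limitDrift
  linarith

lemma coordLimitPenalty_midpoint_le {a γ : ℝ} (hγ : 1 ≤ γ) (x y : ℝ) :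
    coordLimitPenalty a γ (2⁻¹ * (x + y)) ≤
      2⁻¹ * (coordLimitPenalty a γ x + coordLimitPenalty a γ y) := by
  unfold coordLimitPenalty
  split_ifs with h1 h2 h3 h4
  · exact le_of_eq (by ring)
  · rw [abs_mul, abs_of_pos (by norm_num : (0 : ℝ) < 2⁻¹)]
    gcongr
    exact abs_add_le x y
  · exact le_of_eq (by ring)
  · exact absurd (le_antisymm (not_lt.1 h1) hγ) h2
  · exact absurd (le_antisymm (not_lt.1 h1) hγ) h2

/-- For `1 ≤ γ` the limit field is strictly convex. -/
lemma unique_isMinOn_of_one_le {p : ℕ} {C₀ : Matrix (Fin p) (Fin p) ℝ} (hC₀ : C₀.PosDef)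
    (θ₀ : EuclideanSpace ℝ (Fin p)) {γ : ℝ} (hγ : 1 ≤ γ) {lam₀ : ℝ} (hlam₀ : 0 ≤ lam₀)
    {w u v : EuclideanSpace ℝ (Fin p)}
    (hu : IsMinOn (tiltedField (limitDrift C₀ θ₀ γ lam₀) w) Set.univ u)
    (hv : IsMinOn (tiltedField (limitDrift C₀ θ₀ γ lam₀) w) Set.univ v) : u = v := by
  by_contra hne
  obtain ⟨c, hc, hq⟩ := hC₀.exists_mul_norm_sq_le
  have hpos : 0 < c * ‖u - v‖ ^ 2 := by
    have : 0 < ‖u - v‖ := norm_pos_iff.2 (sub_ne_zero.2 hne)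
    positivity
  have h1 : tiltedField (limitDrift C₀ θ₀ γ lam₀) w u ≤
    tiltedField (limitDrift C₀ θ₀ γ lam₀) w ((2⁻¹ : ℝ) • (u + v)) := hu (Set.mem_univ _)
  have h2 : tiltedField (limitDrift C₀ θ₀ γ lam₀) w v ≤
    tiltedField (limitDrift C₀ θ₀ γ lam₀) w ((2⁻¹ : ℝ) • (u + v)) := hv (Set.mem_univ _)
  have hpen : limitPenalty θ₀ γ lam₀ ((2⁻¹ : ℝ) • (u + v)) ≤
      2⁻¹ * (limitPenalty θ₀ γ lam₀ u + limitPenalty θ₀ γ lam₀ v) := by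
    simp only [limitPenalty_eq_sum]
    rw [← mul_add, mul_left_comm, ← Finset.sum_add_distrib, Finset.mul_sum (a := (2⁻¹ : ℝ))]
    refine mul_le_mul_of_nonneg_left (Finset.sum_le_sum fun j _ => ?_) hlam₀
    exact coordLimitPenalty_midpoint_le (a := θ₀ j) hγ (u j) (v j)
  have hquv := hq (u - v)
  simp only [tiltedField, limitDrift, WithLp.ofLp_smul, WithLp.ofLp_add, inner_smul_right,
    inner_add_right, Matrix.mulVec_smul, dotProduct_smul, smul_dotProduct, Matrix.mulVec_add,
    dotProduct_add, add_dotProduct, smul_eq_mul] at h1 h2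
  simp only [WithLp.ofLp_sub, Matrix.mulVec_sub, dotProduct_sub, sub_dotProduct] at hquv
  linarith

theorem ae_existsUnique_isMinOn_limitField {p : ℕ} {C₀ : Matrix (Fin p) (Fin p) ℝ}
    (hC₀ : C₀.PosDef) (θ₀ : EuclideanSpace ℝ (Fin p)) {γ : ℝ} (hγ : 0 < γ) {lam₀ : ℝ}
    (hlam₀ : 0 ≤ lam₀) {v : ℝ} (hv : 0 ≤ v) :
    ∀ᵐ w ∂(multivariateGaussian 0 (v • C₀)),
      ∃! u, IsMinOn (limitField C₀ θ₀ γ lam₀ w) Set.univ u := by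
  rw [limitField_eq_tiltedField]
  have h0 := limitDrift_zero C₀ θ₀ hγ lam₀
  have hcont := continuous_limitDrift C₀ θ₀ hγ lam₀
  obtain ⟨A, hA⟩ := exists_norm_le_of_limitDrift hC₀ θ₀ hγ lam₀
  suffices h : ∀ᵐ w ∂(multivariateGaussian 0 (v • C₀)), ∀ u u',
      IsMinOn (tiltedField (limitDrift C₀ θ₀ γ lam₀) w) Set.univ u →
      IsMinOn (tiltedField (limitDrift C₀ θ₀ γ lam₀) w) Set.univ u' → u = u' by
    filter_upwards [h] with w hw
    obtain ⟨u, hu⟩ := exists_isMinOn_tiltedField hcont h0 hA w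
    exact ⟨u, hu, fun u' hu' => hw u' u hu' hu⟩
  rcases le_or_gt 1 γ with h1 | h1
  · exact Eventually.of_forall fun w u u' hu hu' => unique_isMinOn_of_one_le hC₀ θ₀ h1 hlam₀ hu hu'
  rcases hv.eq_or_lt with rfl | hv
  · -- without noise the score vanishes, and the origin is the minimizer as the penalty is nonnegative
    have hdirac : multivariateGaussian 0 ((0 : ℝ) • C₀) =
        Measure.dirac (0 : EuclideanSpace ℝ (Fin p)) := by
      simp [multivariateGaussian, Measure.map_const]
    rw [hdirac, ae_dirac_eq]
    have hz : ∀ u, IsMinOn (tiltedField (limitDrift C₀ θ₀ γ lam₀) 0) Set.univ u → u = 0 := by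
      intro u hu
      obtain ⟨c, hc, hq⟩ := hC₀.exists_mul_norm_sq_le
      have hu0 : tiltedField (limitDrift C₀ θ₀ γ lam₀) 0 u ≤
        tiltedField (limitDrift C₀ θ₀ γ lam₀) 0 0 := hu (Set.mem_univ _)
      rw [tiltedField_zero h0] at hu0
      have hpen : 0 ≤ limitPenalty θ₀ γ lam₀ u := by
        rw [limitPenalty, if_neg h1.not_gt, if_neg h1.ne]
        refine mul_nonneg hlam₀ (Finset.sum_nonneg fun j _ => ?_)
        split_ifs <;> positivity
      have := hq u
      simp only [tiltedField, limitDrift, inner_zero_left, mul_zero, zero_add] at hu0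
      by_contra hne
      have : 0 < c * ‖u‖ ^ 2 := by
        have : 0 < ‖u‖ := norm_pos_iff.2 hne
        positivity
      linarith
    exact fun u u' hu hu' => (hz u hu).trans (hz u' hu').symm
  · exact (multivariateGaussian_absolutelyContinuous (hC₀.smul hv)).ae_le
      (ae_unique_isMinOn_tiltedField hcont h0 hA)

/-! ### Moments of the score -/

lemma MeasureTheory.MemLp.integrable_fun_pow {Ω : Type*} [MeasurableSpace Ω] {P : Measure Ω}
    [IsFiniteMeasure P] {f : Ω → ℝ} {m : ℕ} (hf : MemLp f m P) :
    Integrable (fun ω => f ω ^ m) P := by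
  refine (integrable_norm_iff (hf.aestronglyMeasurable.pow m)).1 ?_
  simpa [norm_pow] using hf.integrable_norm_pow'

lemma abs_pow_le_one_add_pow {m q : ℕ} (hmq : m ≤ q) (hq : Even q) (x : ℝ) :
    |x| ^ m ≤ 1 + x ^ q := by
  rw [← hq.pow_abs x]
  rcases le_or_gt |x| 1 with h | h
  · exact (pow_le_one₀ (abs_nonneg x) h).trans (by linarith [pow_nonneg (abs_nonneg x) q])
  · exact (pow_le_pow_right₀ h.le hmq).trans (by linarith)

/-- Even moments of a sum of independent centred variables. Expanding
`(∑_{i ≤ m} W i) ^ q` in the last summand, the term that is linear in it has mean zero, so that one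
step multiplies `1 + 𝔼[(∑ W i) ^ q]` by at most `1 + 2 ^ q * M`, where `M` bounds the moments of
orders `2, …, q` of each summand. -/
lemma one_add_integral_sum_pow_le {Ω : Type*} [MeasurableSpace Ω] {P : Measure Ω}
    [IsProbabilityMeasure P] {W : ℕ → Ω → ℝ} (hindep : iIndepFun W P)
    (hL : ∀ i, ∀ q : ℕ, MemLp (W i) q P) (hmean : ∀ i, ∫ ω, W i ω ∂P = 0) {q n : ℕ}
    (hq : Even q) (hq0 : q ≠ 0) {M : ℝ} (hM0 : 0 ≤ M)
    (hM : ∀ i < n, ∀ j, 2 ≤ j → j ≤ q → ∫ ω, |W i ω| ^ j ∂P ≤ M) {m : ℕ} (hm : m ≤ n) :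
    1 + ∫ ω, (∑ i ∈ Finset.range m, W i ω) ^ q ∂P ≤ (1 + 2 ^ q * M) ^ m := by
  induction m with
  | zero => simp [hq0]
  | succ m ih =>
    specialize ih (Nat.le_of_succ_le hm)
    set S : Ω → ℝ := fun ω => ∑ i ∈ Finset.range m, W i ω with hS
    have hSL : ∀ k : ℕ, MemLp S k P := fun k => memLp_finsetSum _ fun i _ => hL i k
    have hind : S ⟂ᵢ[P] W m := by
      have := hindep.indepFun_finsetSum_of_notMem₀ (fun i => (hL i 0).aestronglyMeasurable.aemeasurable)
        (s := Finset.range m) (i := m) (by simp)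
      convert! this using 1
      ext ω; simp [hS]
    have hindpow : ∀ j k : ℕ, (fun ω => S ω ^ j) ⟂ᵢ[P] (fun ω => W m ω ^ k) := fun j k =>
      hind.comp (φ := fun x : ℝ => x ^ j) (ψ := fun x : ℝ => x ^ k) (by fun_prop) (by fun_prop)
    have hterm : ∀ j k : ℕ, Integrable (fun ω => S ω ^ j * W m ω ^ k) P := fun j k =>
      (hindpow j k).integrable_mul (hSL j).integrable_fun_pow (hL m k).integrable_fun_pow
    have hfac : ∀ j k : ℕ, ∫ ω, S ω ^ j * W m ω ^ k ∂P = (∫ ω, S ω ^ j ∂P) * ∫ ω, W m ω ^ k ∂P :=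
      fun j k => (hindpow j k).integral_fun_mul_eq_mul_integral
        (hSL j).integrable_fun_pow.aestronglyMeasurable
        (hL m k).integrable_fun_pow.aestronglyMeasurable
    have hx0 : 0 ≤ ∫ ω, S ω ^ q ∂P := integral_nonneg fun ω => hq.pow_nonneg _
    have hbound : ∀ j ∈ Finset.range q, (∫ ω, S ω ^ j * W m ω ^ (q - j) * (q.choose j : ℝ) ∂P) ≤
        (1 + ∫ ω, S ω ^ q ∂P) * M * q.choose j := by
      intro j hj
      rw [integral_mul_const, hfac]
      refine mul_le_mul_of_nonneg_right ?_ (Nat.cast_nonneg _)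
      have hjq : j < q := Finset.mem_range.1 hj
      by_cases h1 : q - j = 1
      · -- the term linear in the new summand is centred
        rw [h1]; simp only [pow_one, hmean m, mul_zero]; positivity
      · have hSj : |∫ ω, S ω ^ j ∂P| ≤ 1 + ∫ ω, S ω ^ q ∂P := by
          refine abs_integral_le_integral_abs.trans ?_
          have : 1 + ∫ ω, S ω ^ q ∂P = ∫ ω, (1 + S ω ^ q) ∂P := by
            rw [integral_add (integrable_const _) (hSL q).integrable_fun_pow]; simp
          rw [this]
          refine integral_mono (hSL j).integrable_fun_pow.abs
            ((integrable_const _).add (hSL q).integrable_fun_pow) fun ω => ?_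
          simpa only [abs_pow] using abs_pow_le_one_add_pow hjq.le hq (S ω)
        have hWj : |∫ ω, W m ω ^ (q - j) ∂P| ≤ M := by
          refine abs_integral_le_integral_abs.trans ?_
          simp only [abs_pow]
          exact hM m hm _ (by omega) (Nat.sub_le _ _)
        refine (le_abs_self _).trans ?_
        rw [abs_mul]
        exact mul_le_mul hSj hWj (abs_nonneg _) (by positivity)
    have hexp : ∫ ω, (∑ i ∈ Finset.range (m + 1), W i ω) ^ q ∂P =
        ∑ j ∈ Finset.range q, (∫ ω, S ω ^ j * W m ω ^ (q - j) * (q.choose j : ℝ) ∂P) +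
          ∫ ω, S ω ^ q ∂P := by
      simp_rw [Finset.sum_range_succ _ m, add_pow]
      rw [integral_finsetSum _ fun j _ => (hterm j (q - j)).mul_const _, Finset.sum_range_succ]
      simp [hS]
    have hsum : ∑ j ∈ Finset.range q, (q.choose j : ℝ) ≤ 2 ^ q := by
      have h := Nat.sum_range_choose q
      rw [Finset.sum_range_succ] at h
      exact_mod_cast (by omega : ∑ j ∈ Finset.range q, q.choose j ≤ 2 ^ q)
    calc 1 + ∫ ω, (∑ i ∈ Finset.range (m + 1), W i ω) ^ q ∂P
        ≤ 1 + (∑ j ∈ Finset.range q, (1 + ∫ ω, S ω ^ q ∂P) * M * q.choose j +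
          ∫ ω, S ω ^ q ∂P) := by
          rw [hexp]; gcongr with j hj; exact hbound j hj
      _ ≤ 1 + ((1 + ∫ ω, S ω ^ q ∂P) * M * 2 ^ q + ∫ ω, S ω ^ q ∂P) := by
          rw [← Finset.mul_sum]; gcongr
      _ = (1 + ∫ ω, S ω ^ q ∂P) * (1 + 2 ^ q * M) := by ring
      _ ≤ (1 + 2 ^ q * M) ^ m * (1 + 2 ^ q * M) := by gcongr
      _ = _ := (pow_succ _ _).symm

/-- The even moments of `n ^ (-1/2) ∑ b n i * ε i`, with bounded weights, are bounded in `n`. -/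
lemma exists_integral_weighted_sum_pow_le {Ω : Type*} [MeasurableSpace Ω] {P : Measure Ω}
    [IsProbabilityMeasure P] {ε : ℕ → Ω → ℝ} (hindep : iIndepFun ε P)
    (hident : ∀ i, IdentDistrib (ε i) (ε 0) P P) (hL : ∀ i, ∀ q : ℕ, MemLp (ε i) q P)
    (hmean : ∀ i, ∫ ω, ε i ω ∂P = 0) (K : ℝ) {q : ℕ} (hq : Even q) (hq0 : q ≠ 0) :
    ∃ C : ℝ, ∀ n : ℕ, 1 ≤ n → ∀ b : ℕ → ℝ, (∀ i < n, |b i| ≤ K) →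
      ∫ ω, (∑ i ∈ Finset.range n, (√(n : ℝ))⁻¹ * b i * ε i ω) ^ q ∂P ≤ C := by
  set M : ℝ := ∑ j ∈ Finset.range (q + 1), |K| ^ j * ∫ ω, |ε 0 ω| ^ j ∂P with hM
  have hM0 : 0 ≤ M := Finset.sum_nonneg fun j _ =>
    mul_nonneg (by positivity) (integral_nonneg fun ω => by positivity)
  refine ⟨Real.exp (2 ^ q * M), fun n hn b hb => ?_⟩
  have hn0 : (0 : ℝ) < n := by exact_mod_cast hn
  have hsq : (√(n : ℝ))⁻¹ ≤ 1 := inv_le_one_of_one_le₀ (Real.one_le_sqrt.2 (by exact_mod_cast hn))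
  have hsq2 : (√(n : ℝ))⁻¹ ^ 2 = (n : ℝ)⁻¹ := by rw [inv_pow, Real.sq_sqrt hn0.le]
  have h := one_add_integral_sum_pow_le (W := fun i ω => (√(n : ℝ))⁻¹ * b i * ε i ω) (P := P)
    (hindep.comp (fun i x => (√(n : ℝ))⁻¹ * b i * x) fun i => by fun_prop)
    (fun i k => (hL i k).const_mul _) (fun i => by rw [integral_const_mul, hmean, mul_zero])
    (n := n) hq hq0 (M := M / n) (by positivity) (fun i hi j h2j hjq => ?_) le_rfl
  · have h2 : (1 + 2 ^ q * (M / n)) ^ n ≤ Real.exp (2 ^ q * M) := by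
      calc (1 + 2 ^ q * (M / n)) ^ n ≤ Real.exp (2 ^ q * (M / n)) ^ n := by
            gcongr
            rw [add_comm]; exact Real.add_one_le_exp _
        _ = Real.exp (2 ^ q * M) := by
            rw [← Real.exp_nat_mul]; congr 1; field_simp
    linarith
  · have hmom : ∫ ω, |ε i ω| ^ j ∂P = ∫ ω, |ε 0 ω| ^ j ∂P :=
      ((hident i).comp (u := fun x : ℝ => |x| ^ j) (by fun_prop)).integral_eq
    simp only [abs_mul, mul_pow]
    rw [integral_const_mul, hmom]
    have h1 : |(√(n : ℝ))⁻¹| ^ j ≤ (n : ℝ)⁻¹ := by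
      rw [abs_of_nonneg (by positivity), ← hsq2]
      exact pow_le_pow_of_le_one (by positivity) hsq h2j
    have h2 : |b i| ^ j ≤ |K| ^ j := by
      exact pow_le_pow_left₀ (abs_nonneg _) ((hb i hi).trans (le_abs_self K)) _
    have h3 : 0 ≤ ∫ ω, |ε 0 ω| ^ j ∂P := integral_nonneg fun ω => by positivity
    have h4 : |K| ^ j * ∫ ω, |ε 0 ω| ^ j ∂P ≤ M :=
      Finset.single_le_sum (f := fun j => |K| ^ j * ∫ ω, |ε 0 ω| ^ j ∂P)
        (fun j _ => mul_nonneg (by positivity) (integral_nonneg fun ω => by positivity))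
        (Finset.mem_range.2 (Nat.lt_succ_of_le hjq))
    calc _ ≤ (n : ℝ)⁻¹ * |K| ^ j * ∫ ω, |ε 0 ω| ^ j ∂P := by gcongr
      _ ≤ (n : ℝ)⁻¹ * M := by rw [mul_assoc]; gcongr
      _ = M / n := by rw [div_eq_inv_mul]

lemma normalizedScore_apply {p : ℕ} (n : ℕ) (X : ℕ → EuclideanSpace ℝ (Fin p)) (e : ℕ → ℝ)
    (j : Fin p) :
    normalizedScore n X e j = ∑ i ∈ Finset.range n, (√(n : ℝ))⁻¹ * X i j * e i := by
  simp only [normalizedScore, PiLp.smul_apply, WithLp.ofLp_sum, Finset.sum_apply, smul_eq_mul,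
    Finset.mul_sum]
  exact Finset.sum_congr rfl fun i _ => by ring

lemma aemeasurable_normalizedScore {p : ℕ} {Ω : Type*} [MeasurableSpace Ω] {P : Measure Ω}
    (n : ℕ) (X : ℕ → EuclideanSpace ℝ (Fin p)) {ε : ℕ → Ω → ℝ} (hε : ∀ i, AEMeasurable (ε i) P) :
    AEMeasurable (fun ω => normalizedScore n X fun i => ε i ω) P := by
  unfold normalizedScore
  have h : AEMeasurable (fun ω => ∑ i ∈ Finset.range n, ε i ω • X i) P :=
    Finset.aemeasurable_fun_sum _ fun i _ => (hε i).smul_const _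
  exact h.const_smul (√(n : ℝ))⁻¹

/-- All moments of the norm of the score are bounded in `n`. -/
lemma exists_integral_one_add_norm_score_pow_le {p : ℕ} {Ω : Type*} [MeasurableSpace Ω]
    {P : Measure Ω} [IsProbabilityMeasure P] {ε : ℕ → Ω → ℝ} (hindep : iIndepFun ε P)
    (hident : ∀ i, IdentDistrib (ε i) (ε 0) P P) (hL : ∀ i, ∀ q : ℕ, MemLp (ε i) q P)
    (hmean : ∀ i, ∫ ω, ε i ω ∂P = 0) {X : ℕ → ℕ → EuclideanSpace ℝ (Fin p)}
    (hX : ∃ K : ℝ, ∀ n : ℕ, ∀ i < n, ‖X n i‖ ≤ K) (k : ℕ) :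
    ∃ C : ℝ, ∀ n : ℕ, 1 ≤ n →
      Integrable (fun ω => (1 + ‖normalizedScore n (X n) fun i => ε i ω‖) ^ k) P ∧
        ∫ ω, (1 + ‖normalizedScore n (X n) fun i => ε i ω‖) ^ k ∂P ≤ C := by
  obtain ⟨K, hK⟩ := hX
  obtain ⟨C, hC⟩ := exists_integral_weighted_sum_pow_le hindep hident hL hmean K
    (q := 2 * (k + 1)) (even_two_mul _) (by omega)
  have hpt : ∀ s : EuclideanSpace ℝ (Fin p),
      (1 + ‖s‖) ^ k ≤ 2 ^ k * (2 + p ^ k * ∑ j, s j ^ (2 * (k + 1))) := by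
    intro s
    have h1 : ‖s‖ ^ (2 * (k + 1)) ≤ p ^ k * ∑ j, s j ^ (2 * (k + 1)) := by
      rcases Nat.eq_zero_or_pos p with rfl | hp
      · have : s = 0 := Subsingleton.elim _ _
        simp [this]
      · have := pow_sum_div_card_le_sum_pow (s := Finset.univ) (f := fun j : Fin p => s j ^ 2)
          (fun j _ => sq_nonneg _) k
        rw [Finset.card_univ, Fintype.card_fin, div_le_iff₀ (by positivity)] at this
        rw [pow_mul, EuclideanSpace.real_norm_sq_eq]
        simp only [pow_mul]
        linarith
    have h2 : ‖s‖ ^ k ≤ 1 + ‖s‖ ^ (2 * (k + 1)) := by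
      simpa using abs_pow_le_one_add_pow (by omega : k ≤ 2 * (k + 1)) (even_two_mul _) ‖s‖
    have h3 := add_pow_le zero_le_one (norm_nonneg s) k
    have h4 : (2 : ℝ) ^ (k - 1) ≤ 2 ^ k := pow_le_pow_right₀ one_le_two (Nat.sub_le _ _)
    calc _ ≤ 2 ^ (k - 1) * (1 ^ k + ‖s‖ ^ k) := h3
      _ ≤ 2 ^ k * (1 ^ k + ‖s‖ ^ k) := by gcongr
      _ ≤ _ := by
        rw [one_pow]
        exact mul_le_mul_of_nonneg_left (by linarith) (by positivity)
  have hcoord : ∀ (n : ℕ) (j : Fin p), Integrable (fun ω =>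
      (normalizedScore n (X n) fun i => ε i ω) j ^ (2 * (k + 1))) P := by
    intro n j
    simp only [normalizedScore_apply]
    exact (memLp_finsetSum _ fun i _ => (hL i _).const_mul _).integrable_fun_pow
  refine ⟨2 ^ k * (2 + p ^ k * ∑ _j : Fin p, C), fun n hn => ?_⟩
  have hint : Integrable (fun ω => 2 ^ k * (2 + (p : ℝ) ^ k *
      ∑ j, (normalizedScore n (X n) fun i => ε i ω) j ^ (2 * (k + 1)))) P :=
    (((integrable_const _).add ((integrable_finsetSum _ fun j _ => hcoord n j).const_mul _)).const_mul
      _)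
  have hmeas := aemeasurable_normalizedScore n (X n) fun i =>
    (hL i 0).aestronglyMeasurable.aemeasurable
  have hI : Integrable (fun ω => (1 + ‖normalizedScore n (X n) fun i => ε i ω‖) ^ k) P :=
    hint.mono' ((hmeas.norm.const_add 1).pow_const k).aestronglyMeasurable (Eventually.of_forall fun ω => by
      rw [Real.norm_of_nonneg (by positivity)]; exact hpt _)
  refine ⟨hI, (integral_mono hI hint fun ω => hpt _).trans ?_⟩
  rw [integral_const_mul, integral_add (integrable_const _)
    ((integrable_finsetSum _ fun j _ => hcoord n j).const_mul _), integral_const_mul,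
    integral_finsetSum _ fun j _ => hcoord n j]
  simp only [integral_const, probReal_univ, smul_eq_mul, one_mul]
  gcongr with j
  simp only [normalizedScore_apply]
  exact hC n hn (fun i => X n i j) fun i hi => (PiLp.norm_apply_le (X n i) j).trans (hK n i hi)

/-! ### Central limit theorem for the score -/

lemma norm_prod_sub_prod_le_sum {ι : Type*} (s : Finset ι) {f g : ι → ℂ}
    (hf : ∀ i ∈ s, ‖f i‖ ≤ 1) (hg : ∀ i ∈ s, ‖g i‖ ≤ 1) :
    ‖∏ i ∈ s, f i - ∏ i ∈ s, g i‖ ≤ ∑ i ∈ s, ‖f i - g i‖ := by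
  classical
  induction s using Finset.induction_on with
  | empty => simp
  | insert i s hi ih =>
    rw [Finset.prod_insert hi, Finset.prod_insert hi, Finset.sum_insert hi]
    have h1 : f i * ∏ j ∈ s, f j - g i * ∏ j ∈ s, g j =
        (f i - g i) * ∏ j ∈ s, f j + g i * (∏ j ∈ s, f j - ∏ j ∈ s, g j) := by ring
    have h2 : ‖∏ j ∈ s, f j‖ ≤ 1 := by
      rw [norm_prod]
      exact Finset.prod_le_one (fun _ _ => norm_nonneg _) fun j hj =>
        hf j (Finset.mem_insert_of_mem hj)
    have h3 := ih (fun j hj => hf j (Finset.mem_insert_of_mem hj))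
      fun j hj => hg j (Finset.mem_insert_of_mem hj)
    rw [h1]
    refine (norm_add_le _ _).trans (add_le_add ?_ ?_)
    · rw [norm_mul]; exact mul_le_of_le_one_right (norm_nonneg _) h2
    · rw [norm_mul]
      exact (mul_le_of_le_one_left (norm_nonneg _) (hg i (Finset.mem_insert_self _ _))).trans h3

/-- Characteristic functions of two laws with the same first two moments agree to second order. -/
lemma charFun_sub_charFun_isLittleO {μ ν : Measure ℝ} [IsProbabilityMeasure μ]
    [IsProbabilityMeasure ν] (hμ : MemLp id 2 μ) (hν : MemLp id 2 ν)
    (h1 : ∫ x, x ∂μ = ∫ x, x ∂ν) (h2 : ∫ x, x ^ 2 ∂μ = ∫ x, x ^ 2 ∂ν) :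
    (fun t => charFun μ t - charFun ν t) =o[𝓝 0] fun t => t ^ 2 := by
  have hT : ∀ t, taylorWithinEval (charFun μ) 2 Set.univ 0 t =
      taylorWithinEval (charFun ν) 2 Set.univ 0 t := by
    intro t
    rw [taylorWithinEval_charFun_zero (n := 2) (by exact_mod_cast hμ),
      taylorWithinEval_charFun_zero (n := 2) (by exact_mod_cast hν)]
    simp only [Finset.sum_range_succ, Finset.range_zero, Finset.sum_empty, pow_zero, pow_one,
      integral_const, probReal_univ, h1, h2]
  have e1 := taylor_isLittleO_univ (n := 2) (x₀ := 0)
    (contDiff_charFun (μ := μ) (n := 2) (by exact_mod_cast hμ))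
  have e2 := taylor_isLittleO_univ (n := 2) (x₀ := 0)
    (contDiff_charFun (μ := ν) (n := 2) (by exact_mod_cast hν))
  refine (e1.sub e2).congr (fun t => ?_) fun t => by rw [sub_zero]
  rw [hT t, sub_sub_sub_cancel_right]

lemma charFun_map_normalizedScore {p : ℕ} {Ω : Type*} [MeasurableSpace Ω] {P : Measure Ω}
    {ε : ℕ → Ω → ℝ} (hindep : iIndepFun ε P)
    (hident : ∀ i, IdentDistrib (ε i) (ε 0) P P) (n : ℕ) (X : ℕ → EuclideanSpace ℝ (Fin p))
    (t : EuclideanSpace ℝ (Fin p)) :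
    charFun (P.map fun ω => normalizedScore n X fun i => ε i ω) t =
      ∏ i ∈ Finset.range n, charFun (P.map (ε 0)) ((√(n : ℝ))⁻¹ * inner ℝ t (X i)) := by
  have hε : ∀ i, AEMeasurable (ε i) P := fun i => (hident i).aemeasurable_fst
  have hm : ∀ i, AEMeasurable (fun ω => ε i ω • ((√(n : ℝ))⁻¹ • X i)) P :=
    fun i => (hε i).smul_const _
  have hS : (fun ω => normalizedScore n X fun i => ε i ω) =
      fun ω => ∑ i ∈ Finset.range n, ε i ω • ((√(n : ℝ))⁻¹ • X i) := by
    ext ω : 1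
    simp only [normalizedScore, Finset.smul_sum]
    exact Finset.sum_congr rfl fun i _ => smul_comm _ _ _
  have hind : iIndepFun (fun i ω => ε i ω • ((√(n : ℝ))⁻¹ • X i)) P :=
    hindep.comp (fun i (x : ℝ) => x • ((√(n : ℝ))⁻¹ • X i)) fun i => by fun_prop
  rw [hS, iIndepFun.charFun_map_fun_finsetSum_eq_prod (fun i _ => hm i) (hind.restrict _),
    Finset.prod_apply]
  refine Finset.prod_congr rfl fun i _ => ?_
  rw [← (hident i).map_eq, charFun_apply, charFun_apply_real,
    integral_map (hm i) (by fun_prop), integral_map (hε i) (by fun_prop)]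
  congr 1
  ext ω
  simp only [inner_smul_left, RCLike.conj_to_real, real_inner_comm t (X i)]
  push_cast
  ring_nf

lemma sum_sq_inner_eq {p : ℕ} (n : ℕ) (X : ℕ → EuclideanSpace ℝ (Fin p))
    (t : EuclideanSpace ℝ (Fin p)) :
    ∑ i ∈ Finset.range n, ((√(n : ℝ))⁻¹ * inner ℝ t (X i)) ^ 2 =
      t.ofLp ⬝ᵥ (gramMean n X *ᵥ t.ofLp) := by
  rw [dotProduct_gramMean_mulVec, Finset.mul_sum]
  refine Finset.sum_congr rfl fun i _ => ?_
  rw [mul_pow, inv_pow, Real.sq_sqrt (Nat.cast_nonneg n)]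

lemma tendsto_dotProduct_gramMean_mulVec {p : ℕ} {ι : Type*} {l : Filter ι}
    {M : ι → Matrix (Fin p) (Fin p) ℝ} {C₀ : Matrix (Fin p) (Fin p) ℝ}
    (hM : Tendsto M l (𝓝 C₀)) {u : ι → EuclideanSpace ℝ (Fin p)} {u₀ : EuclideanSpace ℝ (Fin p)}
    (hu : Tendsto u l (𝓝 u₀)) :
    Tendsto (fun k => (u k).ofLp ⬝ᵥ (M k *ᵥ (u k).ofLp)) l (𝓝 (u₀.ofLp ⬝ᵥ (C₀ *ᵥ u₀.ofLp))) := by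
  have hc : Continuous fun q : Matrix (Fin p) (Fin p) ℝ × EuclideanSpace ℝ (Fin p) =>
      q.2.ofLp ⬝ᵥ (q.1 *ᵥ q.2.ofLp) := by fun_prop
  exact (hc.tendsto (C₀, u₀)).comp (hM.prodMk_nhds hu)

/-- The score is asymptotically normal. Each factor of its characteristic function is compared with
the Gaussian one of the same variance. -/
theorem tendsto_charFun_normalizedScore {p : ℕ} {Ω : Type*} [MeasurableSpace Ω]
    {P : Measure Ω} [IsProbabilityMeasure P] {ε : ℕ → Ω → ℝ} (hindep : iIndepFun ε P)
    (hident : ∀ i, IdentDistrib (ε i) (ε 0) P P) (hL : MemLp (ε 0) 2 P)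
    (hmean : ∫ ω, ε 0 ω ∂P = 0) {X : ℕ → ℕ → EuclideanSpace ℝ (Fin p)}
    (hX : ∃ K : ℝ, ∀ n : ℕ, ∀ i < n, ‖X n i‖ ≤ K) {C₀ : Matrix (Fin p) (Fin p) ℝ}
    (hC₀ : C₀.PosDef) (hC : Tendsto (fun n => gramMean n (X n)) atTop (𝓝 C₀))
    (t : EuclideanSpace ℝ (Fin p)) :
    Tendsto (fun n => charFun (P.map fun ω => normalizedScore n (X n) fun i => ε i ω) t) atTop
      (𝓝 (charFun (multivariateGaussian 0 ((∫ ω, ε 0 ω ^ 2 ∂P) • C₀)) t)) := by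
  have hv0 : 0 ≤ ∫ ω, ε 0 ω ^ 2 ∂P := integral_nonneg fun ω => sq_nonneg _
  set v : NNReal := ⟨∫ ω, ε 0 ω ^ 2 ∂P, hv0⟩ with hv
  have hε : AEMeasurable (ε 0) P := hL.aestronglyMeasurable.aemeasurable
  have : IsProbabilityMeasure (P.map (ε 0)) := Measure.isProbabilityMeasure_map hε
  set q : ℕ → ℝ := fun n => t.ofLp ⬝ᵥ (gramMean n (X n) *ᵥ t.ofLp) with hq
  have hqlim : Tendsto q atTop (𝓝 (t.ofLp ⬝ᵥ (C₀ *ᵥ t.ofLp))) :=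
    tendsto_dotProduct_gramMean_mulVec hC tendsto_const_nhds
  have hlo : (fun s => charFun (P.map (ε 0)) s - charFun (gaussianReal 0 v) s) =o[𝓝 0]
      fun s => s ^ 2 := by
    refine charFun_sub_charFun_isLittleO ?_ IsGaussian.memLp_two_id ?_ ?_
    · exact (memLp_map_measure_iff (by fun_prop) hε).2 hL
    · rw [integral_map hε (by fun_prop), hmean, integral_id_gaussianReal]
    · rw [integral_map hε (by fun_prop)]
      have h := variance_id_gaussianReal (μ := 0) (v := v)
      rw [variance_of_integral_eq_zero (by fun_prop) (by simp)] at h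
      exact h.symm
  -- the product of the Gaussian factors
  have hgauss : ∀ n, ∏ i ∈ Finset.range n,
      charFun (gaussianReal 0 v) ((√(n : ℝ))⁻¹ * inner ℝ t (X n i)) =
        Complex.exp (-((v : ℝ) * q n / 2 : ℝ)) := by
    intro n
    simp only [charFun_gaussianReal, ← Complex.exp_sum]
    congr 1
    rw [hq]
    simp only [← sum_sq_inner_eq, Finset.mul_sum, Finset.sum_div]
    push_cast
    rw [← Finset.sum_neg_distrib]
    exact Finset.sum_congr rfl fun i _ => by ring
  have hlim : Tendsto (fun n => Complex.exp (-((v : ℝ) * q n / 2 : ℝ))) atTop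
      (𝓝 (charFun (multivariateGaussian 0 ((∫ ω, ε 0 ω ^ 2 ∂P) • C₀)) t)) := by
    rw [charFun_multivariateGaussian (hC₀.posSemidef.smul hv0)]
    have hvv : (v : ℝ) = ∫ ω, ε 0 ω ^ 2 ∂P := rfl
    have h1 := ((hqlim.const_mul (v : ℝ)).div_const 2).neg
    have h2 := (Complex.continuous_exp.tendsto _).comp
      ((Complex.continuous_ofReal.tendsto _).comp h1)
    convert! h2 using 2
    · simp [Function.comp_def]
    · simp [Matrix.smul_mulVec, dotProduct_smul, hvv]
  have hdiff : Tendsto (fun n => charFun (P.map fun ω => normalizedScore n (X n) fun i => ε i ω) t -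
      Complex.exp (-((v : ℝ) * q n / 2 : ℝ))) atTop (𝓝 0) := by
    rw [tendsto_zero_iff_norm_tendsto_zero, Metric.tendsto_atTop]
    intro η hη
    obtain ⟨B, hB⟩ := (Metric.isBounded_range_of_tendsto _ hqlim).exists_norm_le
    have hB0 : 0 ≤ B := (norm_nonneg _).trans (hB _ ⟨0, rfl⟩)
    obtain ⟨K, hK⟩ := hX
    obtain ⟨ρ, hρ, hρ'⟩ := Metric.eventually_nhds_iff.1
      (hlo.def (by positivity : (0 : ℝ) < η / (B + 1)))
    have hsmall : Tendsto (fun n : ℕ => ‖t‖ * |K| / √(n : ℝ)) atTop (𝓝 0) :=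
      tendsto_const_nhds.div_atTop (tendsto_sqrt_natCast tendsto_id)
    obtain ⟨N, hN⟩ := eventually_atTop.1 (hsmall.eventually (gt_mem_nhds hρ))
    refine ⟨N, fun n hn => ?_⟩
    rw [dist_zero_right, norm_norm, charFun_map_normalizedScore hindep hident, ← hgauss n]
    refine (norm_prod_sub_prod_le_sum _ (fun _ _ => norm_charFun_le_one _)
      (fun _ _ => norm_charFun_le_one _)).trans_lt ?_
    calc _ ≤ ∑ i ∈ Finset.range n, η / (B + 1) * ((√(n : ℝ))⁻¹ * inner ℝ t (X n i)) ^ 2 := by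
          refine Finset.sum_le_sum fun i hi => ?_
          have hi' : |(√(n : ℝ))⁻¹ * inner ℝ t (X n i)| < ρ := by
            refine lt_of_le_of_lt ?_ (hN n hn)
            rw [abs_mul, abs_of_nonneg (by positivity : 0 ≤ (√(n : ℝ))⁻¹), div_eq_inv_mul]
            gcongr
            exact (abs_real_inner_le_norm _ _).trans (by
              gcongr; exact (hK n i (Finset.mem_range.1 hi)).trans (le_abs_self K))
          have h := hρ' (y := (√(n : ℝ))⁻¹ * inner ℝ t (X n i)) (by simpa using hi')
          rwa [Real.norm_of_nonneg (sq_nonneg _)] at h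
      _ = η / (B + 1) * q n := by rw [← Finset.mul_sum, sum_sq_inner_eq]
      _ ≤ η / (B + 1) * B := by
          gcongr
          exact (le_abs_self _).trans (hB _ ⟨n, rfl⟩)
      _ < η := by
          rw [div_mul_eq_mul_div, div_lt_iff₀ (by positivity)]
          nlinarith
  simpa using hdiff.add hlim

theorem tendstoInDistribution_normalizedScore {p : ℕ} {Ω Ω' : Type*} [MeasurableSpace Ω]
    [MeasurableSpace Ω'] {P : Measure Ω} [IsProbabilityMeasure P] {P' : Measure Ω'}
    [IsProbabilityMeasure P'] {ε : ℕ → Ω → ℝ} (hindep : iIndepFun ε P)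
    (hident : ∀ i, IdentDistrib (ε i) (ε 0) P P) (hL : MemLp (ε 0) 2 P)
    (hmean : ∫ ω, ε 0 ω ∂P = 0) {X : ℕ → ℕ → EuclideanSpace ℝ (Fin p)}
    (hX : ∃ K : ℝ, ∀ n : ℕ, ∀ i < n, ‖X n i‖ ≤ K) {C₀ : Matrix (Fin p) (Fin p) ℝ}
    (hC₀ : C₀.PosDef) (hC : Tendsto (fun n => gramMean n (X n)) atTop (𝓝 C₀))
    {W : Ω' → EuclideanSpace ℝ (Fin p)}
    (hW : HasLaw W (multivariateGaussian 0 ((∫ ω, ε 0 ω ^ 2 ∂P) • C₀)) P') :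
    TendstoInDistribution (fun n ω => normalizedScore n (X n) fun i => ε i ω) atTop W
      (fun _ => P) P' where
  forall_aemeasurable n :=
    aemeasurable_normalizedScore n (X n) fun i => (hident i).aemeasurable_fst
  aemeasurable_limit := hW.aemeasurable
  tendsto := by
    refine ProbabilityMeasure.tendsto_iff_tendsto_charFun.2 fun t => ?_
    rw! [hW.map_eq]
    exact tendsto_charFun_normalizedScore hindep hident hL hmean hX hC₀ hC t

/-! ### Convergence in distribution and of moments -/

/-- A continuous mapping theorem for relations: if `(S n, u n)` lies almost surely in `R n` and, for
almost every value `T ω` of the limit, the `R n`-images of points tending to `T ω` tend to `u₀ ω`,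
then `S n → T` in distribution implies `u n → u₀` in distribution. -/
theorem tendstoInDistribution_of_relation {Ω Ω' E F : Type*} [MeasurableSpace Ω]
    [MeasurableSpace Ω'] {P : Measure Ω} [IsProbabilityMeasure P] {P' : Measure Ω'}
    [IsProbabilityMeasure P'] [PseudoMetricSpace E] [MeasurableSpace E] [BorelSpace E]
    [TopologicalSpace F] [MeasurableSpace F] [BorelSpace F]
    {S : ℕ → Ω → E} {T : Ω' → E} (hS : TendstoInDistribution S atTop T (fun _ => P) P')
    {u : ℕ → Ω → F} (hu : ∀ n, AEMeasurable (u n) P) {u₀ : Ω' → F} (hu₀ : AEMeasurable u₀ P')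
    {R : ℕ → Set (E × F)} (hR : ∀ᶠ n in atTop, ∀ᵐ ω ∂P, (S n ω, u n ω) ∈ R n)
    (hlim : ∀ᵐ ω ∂P', ∀ (φ : ℕ → ℕ) (s : ℕ → E) (v : ℕ → F), Tendsto φ atTop atTop →
      Tendsto s atTop (𝓝 (T ω)) → (∀ k, (s k, v k) ∈ R (φ k)) → Tendsto v atTop (𝓝 (u₀ ω))) :
    TendstoInDistribution u atTop u₀ (fun _ => P) P' where
  forall_aemeasurable := hu
  aemeasurable_limit := hu₀
  tendsto := by
    refine tendsto_of_forall_isClosed_limsup_le' fun F₀ hF₀ => ?_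
    simp only [ProbabilityMeasure.coe_mk]
    rw [Measure.map_apply_of_aemeasurable hu₀ hF₀.measurableSet]
    -- `A m` collects the points related to `F₀` by some `R n` with `n ≥ m`; limits of such points are
    -- carried into `F₀` by the limit map
    set A : ℕ → Set E := fun m => {s | ∃ n, m ≤ n ∧ ∃ v ∈ F₀, (s, v) ∈ R n} with hA
    have hanti : Antitone fun m => closure (A m) := fun m m' hmm => closure_mono
      fun s ⟨n, hn, v, hv, hs⟩ => ⟨n, hmm.trans hn, v, hv, hs⟩
    have hstep : ∀ m, limsup (fun n => (P.map (u n)) F₀) atTop ≤ P'.map T (closure (A m)) := by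
      intro m
      have h1 := ProbabilityMeasure.limsup_measure_closed_le_of_tendsto hS.tendsto
        (isClosed_closure (s := A m))
      refine le_trans ?_ h1
      refine limsup_le_limsup ?_
      filter_upwards [hR, eventually_ge_atTop m] with n hn hmn
      simp only [ProbabilityMeasure.coe_mk]
      rw [Measure.map_apply_of_aemeasurable (hu n) hF₀.measurableSet,
        Measure.map_apply_of_aemeasurable (hS.forall_aemeasurable n) isClosed_closure.measurableSet]
      refine measure_mono_ae ?_
      filter_upwards [hn] with ω hω hωF
      exact subset_closure ⟨n, hmn, u n ω, hωF, hω⟩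
    have hinter : limsup (fun n => (P.map (u n)) F₀) atTop ≤ P'.map T (⋂ m, closure (A m)) := by
      have : IsProbabilityMeasure (P'.map T) :=
        Measure.isProbabilityMeasure_map hS.aemeasurable_limit
      exact ge_of_tendsto (tendsto_measure_iInter_atTop
        (fun m => isClosed_closure.measurableSet.nullMeasurableSet) hanti
        ⟨0, measure_ne_top _ _⟩) (Eventually.of_forall hstep)
    refine hinter.trans ?_
    rw [Measure.map_apply_of_aemeasurable hS.aemeasurable_limit
      (MeasurableSet.iInter fun m => isClosed_closure.measurableSet)]
    refine measure_mono_ae ?_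
    filter_upwards [hlim] with ω hω hωA
    have hex : ∀ k : ℕ, ∃ s n v, dist (T ω) s < 1 / ((k : ℝ) + 1) ∧ k ≤ n ∧ v ∈ F₀ ∧ (s, v) ∈ R n := by
      intro k
      obtain ⟨s, ⟨n, hn, v, hv, hs⟩, hd⟩ := Metric.mem_closure_iff.1 (Set.mem_iInter.1 hωA k)
        (1 / ((k : ℝ) + 1)) (by positivity)
      exact ⟨s, n, v, hd, hn, hv, hs⟩
    choose s φ v hd hφ hv hs using hex
    refine hF₀.mem_of_tendsto (hω φ s v (tendsto_atTop_mono hφ tendsto_id) ?_ hs)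
      (Eventually.of_forall hv)
    rw [tendsto_iff_dist_tendsto_zero]
    refine squeeze_zero (fun _ => dist_nonneg) (fun k => ?_) tendsto_one_div_add_atTop_nhds_zero_nat
    rw [dist_comm]
    exact (hd k).le

lemma abs_sub_clip_le {R : ℝ} (hR : 0 < R) (x : ℝ) : |x - max (-R) (min R x)| ≤ x ^ 2 / R := by
  rw [le_div_iff₀ hR]
  rcases le_or_gt x (-R) with h | h
  · rw [min_eq_right (by linarith), max_eq_left h, abs_of_nonpos (by linarith)]
    nlinarith
  · rcases le_or_gt x R with h' | h'
    · rw [min_eq_right h', max_eq_right h.le]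
      simp [sq_nonneg]
    · rw [min_eq_left h'.le, max_eq_right (by linarith), abs_of_pos (by linarith)]
      nlinarith

lemma abs_integral_sub_clip_le {Ω : Type*} [MeasurableSpace Ω] {P : Measure Ω}
    [IsProbabilityMeasure P] {V : Ω → ℝ} (hV : MemLp V 2 P) {R : ℝ} (hR : 0 < R) :
    |∫ ω, V ω ∂P - ∫ ω, max (-R) (min R (V ω)) ∂P| ≤ (∫ ω, V ω ^ 2 ∂P) / R := by
  have h1 : Integrable V P := hV.integrable one_le_two
  have h2 : Integrable (fun ω => max (-R) (min R (V ω))) P :=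
    (integrable_const _).sup ((integrable_const _).inf h1)
  rw [← integral_sub h1 h2, ← integral_div]
  exact abs_integral_le_integral_abs.trans (integral_mono (h1.sub h2).abs
    (hV.integrable_sq.div_const _) fun ω => abs_sub_clip_le hR _)

/-- Convergence in distribution together with bounded second moments implies convergence of
expectations. -/
theorem tendsto_integral_of_tendstoInDistribution {Ω Ω' : Type*} [MeasurableSpace Ω]
    [MeasurableSpace Ω'] {P : Measure Ω} [IsProbabilityMeasure P] {P' : Measure Ω'}
    [IsProbabilityMeasure P'] {Z : ℕ → Ω → ℝ} {Z₀ : Ω' → ℝ}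
    (hZ : TendstoInDistribution Z atTop Z₀ (fun _ => P) P') {C : ℝ}
    (hint : ∀ᶠ n in atTop, MemLp (Z n) 2 P ∧ ∫ ω, Z n ω ^ 2 ∂P ≤ C) (hint₀ : MemLp Z₀ 2 P') :
    Tendsto (fun n => ∫ ω, Z n ω ∂P) atTop (𝓝 (∫ ω, Z₀ ω ∂P')) := by
  set I : ℝ := ∫ ω, Z₀ ω ^ 2 ∂P' with hI
  have hI0 : 0 ≤ I := integral_nonneg fun ω => sq_nonneg _
  rw [Metric.tendsto_atTop']
  intro η hη
  -- clipping at level `R` costs at most `C / R` and `I / R` in expectation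
  set R : ℝ := 4 * (|C| + I + 1) / η with hR
  have hR0 : 0 < R := by positivity
  have hCR : C / R ≤ η / 4 := by
    rw [div_le_iff₀ hR0, hR]
    field_simp
    linarith [le_abs_self C]
  have hIR : I / R ≤ η / 4 := by
    rw [div_le_iff₀ hR0, hR]
    field_simp
    linarith [abs_nonneg C]
  let c : BoundedContinuousFunction ℝ ℝ := BoundedContinuousFunction.ofNormedAddCommGroup
    (fun x => max (-R) (min R x)) (by fun_prop) R fun x => by
      rw [Real.norm_eq_abs, abs_le]
      exact ⟨le_max_left _ _, max_le (by linarith) (min_le_left _ _)⟩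
  have hc := ProbabilityMeasure.tendsto_iff_forall_integral_tendsto.1 hZ.tendsto c
  have hcmap : ∀ {V : Ω → ℝ}, AEMeasurable V P →
      ∫ x, c x ∂(P.map V) = ∫ ω, max (-R) (min R (V ω)) ∂P := fun hV =>
    integral_map hV c.continuous.aestronglyMeasurable
  have hcmap₀ : ∫ x, c x ∂(P'.map Z₀) = ∫ ω, max (-R) (min R (Z₀ ω)) ∂P' :=
    integral_map hZ.aemeasurable_limit c.continuous.aestronglyMeasurable
  simp only [ProbabilityMeasure.coe_mk, hcmap₀, hcmap (hZ.forall_aemeasurable _)] at hc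
  have hev := hint.and ((Metric.tendsto_nhds.1 hc) (η / 4) (by positivity))
  obtain ⟨N, hN⟩ := eventually_atTop.1 hev
  refine ⟨N, fun n hn => ?_⟩
  obtain ⟨⟨hn1, hn2⟩, hn3⟩ := hN n hn.le
  have e1 := abs_le.1 (abs_integral_sub_clip_le hn1 hR0)
  have e2 := abs_le.1 (abs_integral_sub_clip_le hint₀ hR0)
  have e3 : (∫ ω, Z n ω ^ 2 ∂P) / R ≤ C / R := by gcongr
  rw [Real.dist_eq, abs_lt] at hn3 ⊢
  constructor <;> linarith [e1.1, e1.2, e2.1, e2.2, hn3.1, hn3.2]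

/-! ### The estimator as a minimizer of the local field -/

/-- The rescaled parameter space `√n (Θ - θ₀)`. -/
def localParameterSpace {p : ℕ} (Θ : Set (EuclideanSpace ℝ (Fin p)))
    (θ₀ : EuclideanSpace ℝ (Fin p)) (n : ℕ) : Set (EuclideanSpace ℝ (Fin p)) :=
  {u | θ₀ + (√(n : ℝ))⁻¹ • u ∈ Θ}

lemma eventually_mem_localParameterSpace {p : ℕ} {Θ : Set (EuclideanSpace ℝ (Fin p))}
    {θ₀ : EuclideanSpace ℝ (Fin p)} (hθ₀ : θ₀ ∈ interior Θ) (v : EuclideanSpace ℝ (Fin p)) :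
    ∀ᶠ n in atTop, v ∈ localParameterSpace Θ θ₀ n := by
  have h1 : Tendsto (fun n : ℕ => (√(n : ℝ))⁻¹) atTop (𝓝 0) :=
    tendsto_inv_atTop_zero.comp (tendsto_sqrt_natCast tendsto_id)
  have h2 : Tendsto (fun n : ℕ => θ₀ + (√(n : ℝ))⁻¹ • v) atTop (𝓝 θ₀) := by
    simpa using (h1.smul_const v).const_add θ₀
  exact h2.eventually (mem_interior_iff_mem_nhds.1 hθ₀)

lemma isMinOn_localDrift {p n : ℕ} (hn : 1 ≤ n) {X : ℕ → EuclideanSpace ℝ (Fin p)}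
    {Y e : ℕ → ℝ} {θ₀ θ u : EuclideanSpace ℝ (Fin p)} {Θ : Set (EuclideanSpace ℝ (Fin p))}
    (hY : ∀ i < n, Y i = inner ℝ θ₀ (X i) + e i) {lam γ : ℝ} (hu : u = √(n : ℝ) • (θ - θ₀))
    (hmem : θ ∈ Θ) (hmin : IsMinOn (bridgeContrast n X Y lam γ) Θ θ) :
    u ∈ localParameterSpace Θ θ₀ n ∧
      IsMinOn (tiltedField (localDrift n X θ₀ lam γ) (normalizedScore n X e))
        (localParameterSpace Θ θ₀ n) u := by
  have hn' : √(n : ℝ) ≠ 0 := (Real.sqrt_pos.2 (by exact_mod_cast hn)).ne'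
  have hθ : θ₀ + (√(n : ℝ))⁻¹ • u = θ := by
    rw [hu, smul_smul, inv_mul_cancel₀ hn', one_smul, add_sub_cancel]
  refine ⟨by simpa [localParameterSpace, hθ] using hmem, fun v hv => ?_⟩
  change tiltedField _ _ u ≤ tiltedField _ _ v
  rw [← bridgeContrast_sub_eq_tiltedField hn hY, ← bridgeContrast_sub_eq_tiltedField hn hY, hθ]
  exact sub_le_sub_right (hmin hv) _

/-- Coercivity of the local fields, uniformly in `n`: for large `n` the Gram matrices are uniformly
positive definite and dominate the penalty, while for the remaining `n` the rescaled parameter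
space itself is bounded. -/
lemma exists_norm_le_of_localDrift {p : ℕ} {Θ : Set (EuclideanSpace ℝ (Fin p))}
    (hΘ : IsCompact Θ) {θ₀ : EuclideanSpace ℝ (Fin p)} (hθ₀ : θ₀ ∈ Θ)
    {X : ℕ → ℕ → EuclideanSpace ℝ (Fin p)} {C₀ : Matrix (Fin p) (Fin p) ℝ} (hC₀ : C₀.PosDef)
    (hC : Tendsto (fun n => gramMean n (X n)) atTop (𝓝 C₀)) {γ : ℝ} (hγ : 0 < γ)
    {lam : ℕ → ℝ} {lam₀ : ℝ}
    (hlam : Tendsto (fun n : ℕ => lam n / (n : ℝ) ^ (min 1 γ / 2)) atTop (𝓝 lam₀)) :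
    ∃ A : ℝ, 0 ≤ A ∧ ∀ n : ℕ, 1 ≤ n → ∀ s, ∀ u ∈ localParameterSpace Θ θ₀ n,
      tiltedField (localDrift n (X n) θ₀ (lam n) γ) s u ≤ 0 → ‖u‖ ≤ A * (1 + ‖s‖) := by
  obtain ⟨c, hc, hq⟩ := hC₀.exists_mul_norm_sq_le
  obtain ⟨B, hB, hpen⟩ := exists_abs_penaltyIncrement_le hΘ hθ₀ hγ hlam
  obtain ⟨R, hR⟩ := hΘ.isBounded.exists_norm_le
  have hR0 : 0 ≤ R := (norm_nonneg _).trans (hR _ hθ₀)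
  have hC' : Tendsto (fun n => ‖gramMean n (X n) - C₀‖) atTop (𝓝 0) :=
    tendsto_iff_norm_sub_tendsto_zero.1 hC
  obtain ⟨N, hN⟩ := eventually_atTop.1 (hC'.eventually (gt_mem_nhds (half_pos hc)))
  refine ⟨max (1 + (2 + 2 * B) / (c / 2)) (√(N : ℝ) * (2 * R)),
    le_max_of_le_right (by positivity), fun n hn s u hu hs => ?_⟩
  rcases le_or_gt N n with hNn | hNn
  · refine (norm_le_of_tiltedField_nonpos (half_pos hc) hB ?_ hs).trans
      (mul_le_mul_of_nonneg_right (le_max_left _ _) (by positivity))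
    have h1 := hq u
    have h2 := (abs_le.1 (hpen n hn u hu)).1
    have h3 := (abs_le.1 (abs_dotProduct_mulVec_le (gramMean n (X n) - C₀) u)).1
    have h4 := mul_le_mul_of_nonneg_right (hN n hNn).le (sq_nonneg ‖u‖)
    rw [Matrix.sub_mulVec, dotProduct_sub] at h3
    unfold localDrift
    linarith
  · have hn' : √(n : ℝ) ≠ 0 := (Real.sqrt_pos.2 (by exact_mod_cast hn)).ne'
    have h1 : u = √(n : ℝ) • ((θ₀ + (√(n : ℝ))⁻¹ • u) - θ₀) := by
      rw [add_sub_cancel_left, smul_smul, mul_inv_cancel₀ hn', one_smul]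
    have h2 : ‖u‖ ≤ √(N : ℝ) * (2 * R) := by
      rw [h1, norm_smul, Real.norm_of_nonneg (Real.sqrt_nonneg _)]
      gcongr
      exact (norm_sub_le _ _).trans (by linarith [hR _ hu, hR _ hθ₀])
    refine (h2.trans (le_max_right (1 + (2 + 2 * B) / (c / 2)) _)).trans ?_
    refine le_mul_of_one_le_right (le_max_of_le_right (by positivity)) ?_
    linarith [norm_nonneg s]

lemma one_add_norm_pow_le {p : ℕ} {A : ℝ} {s u : EuclideanSpace ℝ (Fin p)}
    (h : ‖u‖ ≤ A * (1 + ‖s‖)) (k : ℕ) :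
    (1 + ‖u‖) ^ k ≤ (1 + A) ^ k * (1 + ‖s‖) ^ k := by
  rw [← mul_pow]
  gcongr
  nlinarith [norm_nonneg s]

/-! ### The minimizer of the limit field as a random vector -/

/-- The minimizer of the limit field depends continuously on the tilt wherever it is unique, and is
therefore measurable as a function of the Gaussian vector. -/
lemma aemeasurable_argmin {p : ℕ} {Ω' : Type*} [MeasurableSpace Ω'] {P' : Measure Ω'}
    {g : EuclideanSpace ℝ (Fin p) → ℝ} {A : ℝ} (hcont : Continuous g) (h0 : g 0 = 0)
    (hA : ∀ s u, tiltedField g s u ≤ 0 → ‖u‖ ≤ A * (1 + ‖s‖))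
    {W u₀ : Ω' → EuclideanSpace ℝ (Fin p)} (hW : AEMeasurable W P')
    (huniq : ∀ᵐ w ∂(P'.map W), ∃! u, IsMinOn (tiltedField g w) Set.univ u)
    (hu₀ : ∀ᵐ ω ∂P', IsMinOn (tiltedField g (W ω)) Set.univ (u₀ ω)) : AEMeasurable u₀ P' := by
  choose m hm using exists_isMinOn_tiltedField hcont h0 hA
  have hmcont : ∀ w, (∃! u, IsMinOn (tiltedField g w) Set.univ u) → ContinuousAt m w := by
    intro w hw
    refine tendsto_of_seq_tendsto fun s hs => ?_
    exact tendsto_argmin_tiltedField (G := fun _ => g) (g := g) (U := fun _ => Set.univ)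
      (φ := id) (s := s) (s₀ := w) (fun v => Eventually.of_forall fun _ => Set.mem_univ _)
      (fun φ x x₀ _ hx => (hcont.tendsto x₀).comp hx) (fun _ => h0)
      (Eventually.of_forall fun _ s u _ => hA s u) tendsto_id hs
      (fun k => ⟨Set.mem_univ _, hm (s k)⟩) fun v hv => hw.unique hv (hm w)
  have hmm : AEMeasurable m (P'.map W) := by
    set D : Set (EuclideanSpace ℝ (Fin p)) :=
      (toMeasurable (P'.map W) {w | ¬ ∃! u, IsMinOn (tiltedField g w) Set.univ u})ᶜ with hD
    have hDm : MeasurableSet D := (measurableSet_toMeasurable _ _).compl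
    have hDsub : ∀ w ∈ D, ∃! u, IsMinOn (tiltedField g w) Set.univ u := by
      intro w hw
      by_contra hcon
      exact hw (subset_toMeasurable _ _ hcon)
    have hDae : ∀ᵐ w ∂(P'.map W), w ∈ D := by
      rw [ae_iff]
      simpa [hD, measure_toMeasurable] using ae_iff.1 huniq
    have hDc : ContinuousOn m D := fun w hw => (hmcont w (hDsub w hw)).continuousWithinAt
    have h := hDc.aemeasurable (μ := P'.map W) hDm
    rwa [Measure.restrict_eq_self_of_ae_mem hDae] at h
  refine (hmm.comp_aemeasurable hW).congr ?_
  filter_upwards [ae_of_ae_map hW huniq, hu₀] with ω h1 h2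
  exact h1.unique (hm (W ω)) h2

/-! ### Tail bounds and convergence of moments for the bridge estimator -/

lemma PolynomialGrowth.exists_sq_le {E : Type*} [SeminormedAddCommGroup E] {f : E → ℝ}
    (hf : PolynomialGrowth f) :
    ∃ (K : ℝ) (k : ℕ), 0 ≤ K ∧ ∀ x, f x ^ 2 ≤ K * (1 + ‖x‖) ^ k := by
  obtain ⟨K, k, hK⟩ := hf
  refine ⟨K ^ 2, k * 2, sq_nonneg K, fun x => ?_⟩
  rw [pow_mul, ← mul_pow, ← sq_abs (f x)]
  exact pow_le_pow_left₀ (abs_nonneg _) (hK x) 2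

theorem mainTheorem2 {p : ℕ} {Ω : Type a} [MeasurableSpace Ω]
    (P : Measure Ω) [IsProbabilityMeasure P]
    -- compact parameter space and the true value in its interior
    (Θ : Set (EuclideanSpace ℝ (Fin p))) (hΘ : IsCompact Θ)
    (θ₀ : EuclideanSpace ℝ (Fin p)) (hθ₀ : θ₀ ∈ interior Θ)
    -- non-random covariates, which may depend on the sample size `n`
    (X : ℕ → ℕ → EuclideanSpace ℝ (Fin p))
    -- noise: i.i.d., centred, with finite absolute moments of all orders
    (ε : ℕ → Ω → ℝ) (hindep : iIndepFun ε P) (hident : ∀ i, IdentDistrib (ε i) (ε 0) P P)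
    (hmean : ∀ i, ∫ ω, ε i ω ∂P = 0)
    (hmom : ∀ i, ∀ k : ℝ, 0 < k → Integrable (fun ω => |ε i ω| ^ k) P)
    -- the linear regression model
    (Y : ℕ → ℕ → Ω → ℝ) (hY : ∀ n, ∀ i < n, ∀ ω, Y n i ω = inner ℝ θ₀ (X n i) + ε i ω)
    -- bridge index and tuning parameters
    (γ : ℝ) (hγ : 0 < γ) (lam : ℕ → ℝ) (lam₀ : ℝ) (hlam₀ : 0 ≤ lam₀)
    (hlam : Tendsto (fun n : ℕ => lam n / (n : ℝ) ^ (min 1 γ / 2)) atTop (𝓝 lam₀))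
    -- design conditions
    (δ : ℝ) (hδ : 0 < δ) (C₀ : Matrix (Fin p) (Fin p) ℝ) (hC₀ : C₀.PosDef)
    (hC : ∃ K : ℝ, ∀ n : ℕ, 1 ≤ n → (n : ℝ) ^ δ * ‖gramMean n (X n) - C₀‖ ≤ K)
    (hX : ∃ K : ℝ, ∀ n : ℕ, ∀ i < n, ‖X n i‖ ≤ K)
    -- the estimator: a (measurable) minimizer of the contrast over the parameter space
    (θhat : ℕ → Ω → EuclideanSpace ℝ (Fin p)) (hmeas : ∀ n, 1 ≤ n → AEMeasurable (θhat n) P)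
    (hmem : ∀ n, 1 ≤ n → ∀ᵐ ω ∂P, θhat n ω ∈ Θ)
    (hmin : ∀ n, 1 ≤ n → ∀ᵐ ω ∂P,
      IsMinOn (bridgeContrast n (X n) (fun i => Y n i ω) (lam n) γ) Θ (θhat n ω))
    -- the scaled estimation error
    (uhat : ℕ → Ω → EuclideanSpace ℝ (Fin p))
    (huhat : ∀ n ω, uhat n ω = √(n : ℝ) • (θhat n ω - θ₀)) :
    -- polynomial type large deviation inequality
    (∀ L : ℝ, 0 < L → ∃ c : ℝ, 0 < c ∧ ∀ r : ℝ, 0 < r → ∀ n : ℕ, 1 ≤ n →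
      P.real {ω | r ≤ ‖uhat n ω‖} ≤ c / r ^ L) ∧
    -- the limit field has almost surely exactly one minimizer
    (∀ᵐ w ∂(multivariateGaussian 0 ((∫ ω, ε 0 ω ^ 2 ∂P) • C₀)),
      ∃! u, IsMinOn (limitField C₀ θ₀ γ lam₀ w) Set.univ u) ∧
    -- convergence of moments, for every realization of `W` and of the minimizer `û₀`
    (∀ (Ω' : Type b) [MeasurableSpace Ω'] (P' : Measure Ω') [IsProbabilityMeasure P']
      (W u₀ : Ω' → EuclideanSpace ℝ (Fin p)),
      HasLaw W (multivariateGaussian 0 ((∫ ω, ε 0 ω ^ 2 ∂P) • C₀)) P' →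
      (∀ᵐ ω ∂P', IsMinOn (limitField C₀ θ₀ γ lam₀ (W ω)) Set.univ (u₀ ω)) →
      ∀ f : EuclideanSpace ℝ (Fin p) → ℝ, Continuous f → PolynomialGrowth f →
        (∀ n, 1 ≤ n → Integrable (fun ω => f (uhat n ω)) P) ∧
        Integrable (fun ω => f (u₀ ω)) P' ∧
        Tendsto (fun n => ∫ ω, f (uhat n ω) ∂P) atTop (𝓝 (∫ ω, f (u₀ ω) ∂P'))) := by
  have hθ₀' : θ₀ ∈ Θ := interior_subset hθ₀
  have hgram := tendsto_gramMean hδ hC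
  have hεm : ∀ i, AEMeasurable (ε i) P := fun i => (hident i).aemeasurable_fst
  have hL : ∀ i, ∀ q : ℕ, MemLp (ε i) q P := by
    intro i q
    rcases Nat.eq_zero_or_pos q with rfl | hq
    · simpa using (hεm i).aestronglyMeasurable
    · refine (integrable_norm_rpow_iff (hεm i).aestronglyMeasurable (by positivity)
        (by simp)).1 ?_
      simpa using hmom i q (by exact_mod_cast hq)
  have hum : ∀ n, AEMeasurable (uhat n) P := by
    intro n
    rcases Nat.eq_zero_or_pos n with rfl | hn
    · -- `θhat 0` need not be measurable, but the factor `√0` removes it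
      have : uhat 0 = fun _ => 0 := by ext ω : 1; simp [huhat]
      rw [this]; exact aemeasurable_const
    · have : uhat n = fun ω => √(n : ℝ) • (θhat n ω - θ₀) := funext (huhat n)
      rw [this]; exact ((hmeas n hn).sub_const θ₀).const_smul (√(n : ℝ))
  have hmin' : ∀ n, 1 ≤ n → ∀ᵐ ω ∂P, uhat n ω ∈ localParameterSpace Θ θ₀ n ∧
      IsMinOn (tiltedField (localDrift n (X n) θ₀ (lam n) γ)
        (normalizedScore n (X n) fun i => ε i ω)) (localParameterSpace Θ θ₀ n) (uhat n ω) := by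
    intro n hn
    filter_upwards [hmem n hn, hmin n hn] with ω h1 h2
    exact isMinOn_localDrift hn (fun i hi => hY n i hi ω) (huhat n ω) h1 h2
  have hdrift0 : ∀ n, localDrift n (X n) θ₀ (lam n) γ 0 = 0 := fun n => by
    simp [localDrift, penaltyIncrement]
  obtain ⟨A, hA0, hA⟩ := exists_norm_le_of_localDrift hΘ hθ₀' hC₀ hgram hγ hlam
  have hbound : ∀ n, 1 ≤ n → ∀ᵐ ω ∂P,
      ‖uhat n ω‖ ≤ A * (1 + ‖normalizedScore n (X n) fun i => ε i ω‖) := by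
    intro n hn
    filter_upwards [hmin' n hn] with ω hω
    refine hA n hn _ _ hω.1 ((hω.2 ?_).trans (tiltedField_zero (hdrift0 n) _).le)
    simpa [localParameterSpace] using hθ₀'
  have hmoments : ∀ k : ℕ, ∃ C : ℝ, ∀ n, 1 ≤ n →
      Integrable (fun ω => (1 + ‖uhat n ω‖) ^ k) P ∧ ∫ ω, (1 + ‖uhat n ω‖) ^ k ∂P ≤ C := by
    intro k
    obtain ⟨C, hCk⟩ := exists_integral_one_add_norm_score_pow_le hindep hident hL hmean hX k
    refine ⟨(1 + A) ^ k * C, fun n hn => ?_⟩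
    obtain ⟨h1, h2⟩ := hCk n hn
    have hle : ∀ᵐ ω ∂P, (1 + ‖uhat n ω‖) ^ k ≤
        (1 + A) ^ k * (1 + ‖normalizedScore n (X n) fun i => ε i ω‖) ^ k := by
      filter_upwards [hbound n hn] with ω hω using one_add_norm_pow_le hω k
    have hI : Integrable (fun ω => (1 + ‖uhat n ω‖) ^ k) P :=
      (h1.const_mul _).mono' (((hum n).norm.const_add 1).pow_const k).aestronglyMeasurable (by
        filter_upwards [hle] with ω hω
        rwa [Real.norm_of_nonneg (by positivity)])
    refine ⟨hI, (integral_mono_ae hI (h1.const_mul _) hle).trans ?_⟩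
    rw [integral_const_mul]
    gcongr
  have huniq := ae_existsUnique_isMinOn_limitField hC₀ θ₀ hγ hlam₀
    (integral_nonneg fun ω => sq_nonneg (ε 0 ω) : 0 ≤ ∫ ω, ε 0 ω ^ 2 ∂P)
  refine ⟨fun L hL0 => ?_, huniq, ?_⟩
  · obtain ⟨C, hCk⟩ := hmoments ⌈L⌉₊
    refine ⟨max 1 C, by positivity, fun r hr n hn => ?_⟩
    have hrL : 0 < r ^ L := Real.rpow_pos_of_pos hr L
    rw [le_div_iff₀ hrL]
    obtain ⟨hI, hIC⟩ := hCk n hn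
    rcases le_or_gt r 1 with hr1 | hr1
    · calc _ ≤ 1 * (1 : ℝ) := by
            gcongr
            · exact measureReal_le_one
            · exact Real.rpow_le_one hr.le hr1 hL0.le
        _ ≤ max 1 C := by simp
    · have hmarkov := mul_meas_ge_le_integral_of_nonneg
        (Eventually.of_forall fun ω => by positivity) hI (r ^ ⌈L⌉₊)
      have hrk : r ^ L ≤ r ^ ⌈L⌉₊ := by
        rw [← Real.rpow_natCast]
        exact Real.rpow_le_rpow_of_exponent_le hr1.le (Nat.le_ceil L)
      have hsub : P.real {ω | r ≤ ‖uhat n ω‖} ≤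
          P.real {ω | r ^ ⌈L⌉₊ ≤ (1 + ‖uhat n ω‖) ^ ⌈L⌉₊} :=
        measureReal_mono fun ω hω => pow_le_pow_left₀ hr.le
          (le_trans hω (le_add_of_nonneg_left zero_le_one)) _
      calc _ ≤ P.real {ω | r ^ ⌈L⌉₊ ≤ (1 + ‖uhat n ω‖) ^ ⌈L⌉₊} * r ^ ⌈L⌉₊ := by gcongr
        _ ≤ C := by rw [mul_comm]; exact hmarkov.trans hIC
        _ ≤ _ := le_max_right _ _
  intro Ω' _ P' _ W u₀ hW hu₀ f hf hgrowth
  rw [limitField_eq_tiltedField] at huniq hu₀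
  have hg0 := limitDrift_zero C₀ θ₀ hγ lam₀
  have hgcont := continuous_limitDrift C₀ θ₀ hγ lam₀
  obtain ⟨A', hA'⟩ := exists_norm_le_of_limitDrift hC₀ θ₀ hγ lam₀
  have huniqW : ∀ᵐ ω ∂P', ∃! u,
      IsMinOn (tiltedField (limitDrift C₀ θ₀ γ lam₀) (W ω)) Set.univ u :=
    ae_of_ae_map hW.aemeasurable (hW.map_eq ▸ huniq)
  have hu₀m : AEMeasurable u₀ P' :=
    aemeasurable_argmin hgcont hg0 hA' hW.aemeasurable (hW.map_eq ▸ huniq) hu₀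
  have hdist : TendstoInDistribution uhat atTop u₀ (fun _ => P) P' := by
    refine tendstoInDistribution_of_relation
      (tendstoInDistribution_normalizedScore hindep hident (by exact_mod_cast hL 0 2) (hmean 0) hX
        hC₀ hgram hW) hum hu₀m
      (R := fun n => {q | q.2 ∈ localParameterSpace Θ θ₀ n ∧
        IsMinOn (tiltedField (localDrift n (X n) θ₀ (lam n) γ) q.1)
          (localParameterSpace Θ θ₀ n) q.2}) ?_ ?_
    · filter_upwards [eventually_ge_atTop 1] with n hn using hmin' n hn
    · filter_upwards [huniqW, hu₀] with ω h1 h2 φ s v hφ hs hv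
      exact tendsto_argmin_tiltedField (eventually_mem_localParameterSpace hθ₀)
        (fun φ x x₀ hφ hx => (tendsto_dotProduct_gramMean_mulVec (hgram.comp hφ) hx).add
          (tendsto_penaltyIncrement hφ hx θ₀ hγ hlam)) hdrift0
        ((eventually_ge_atTop 1).mono hA) hφ hs hv fun w hw => h1.unique hw h2
  obtain ⟨K, k, hK0, hK⟩ := hgrowth.exists_sq_le
  obtain ⟨C, hCk⟩ := hmoments k
  have hmem2 : ∀ n, 1 ≤ n →
      MemLp (fun ω => f (uhat n ω)) 2 P ∧ ∫ ω, f (uhat n ω) ^ 2 ∂P ≤ K * C := by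
    intro n hn
    obtain ⟨h1, h2⟩ := hCk n hn
    have hfm : AEStronglyMeasurable (fun ω => f (uhat n ω)) P :=
      (hf.measurable.comp_aemeasurable (hum n)).aestronglyMeasurable
    have hI : Integrable (fun ω => f (uhat n ω) ^ 2) P :=
      (h1.const_mul K).mono' (hfm.pow 2) (Eventually.of_forall fun ω => by
        rw [Real.norm_of_nonneg (sq_nonneg _)]; exact hK _)
    refine ⟨(memLp_two_iff_integrable_sq hfm).2 hI,
      (integral_mono hI (h1.const_mul K) fun ω => hK _).trans ?_⟩
    rw [integral_const_mul]
    gcongr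
  have hmem2₀ : MemLp (fun ω => f (u₀ ω)) 2 P' := by
    have hfm : AEStronglyMeasurable (fun ω => f (u₀ ω)) P' :=
      (hf.measurable.comp_aemeasurable hu₀m).aestronglyMeasurable
    refine (memLp_two_iff_integrable_sq hfm).2 ?_
    have hWL : MemLp W k P' := by
      have h : MemLp id k (P'.map W) := by
        rw [hW.map_eq]; exact IsGaussian.memLp_id _ _ (by simp)
      exact (memLp_map_measure_iff aestronglyMeasurable_id hW.aemeasurable).1 h
    have hI : Integrable (fun ω => (1 + ‖W ω‖) ^ k) P' :=
      ((memLp_const (1 : ℝ)).add hWL.norm).integrable_fun_pow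
    refine ((hI.const_mul ((1 + |A'|) ^ k)).const_mul K).mono' (hfm.pow 2) ?_
    filter_upwards [hu₀] with ω hω
    rw [Real.norm_of_nonneg (sq_nonneg _)]
    refine (hK _).trans ?_
    gcongr
    refine one_add_norm_pow_le ?_ k
    refine (hA' _ _ ((hω (Set.mem_univ 0)).trans (tiltedField_zero hg0 _).le)).trans ?_
    gcongr
    exact le_abs_self A'
  exact ⟨fun n hn => (hmem2 n hn).1.integrable one_le_two, hmem2₀.integrable one_le_two,
    tendsto_integral_of_tendstoInDistribution (hdist.continuous_comp hf)
      ((eventually_ge_atTop 1).mono hmem2) hmem2₀⟩
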